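/- Let $\mathrm{Diff}^1_0(S^2)$ be the connected component of the identity in the group of $C^1$-diffeomorphisms of the 2-sphere with the $C^1$-topology. An element $f$ of a group $G$ is a *distortion element* of $G$ if it has infinite order and there is a finite set $S\subset G$ such that $f$ lies in the subgroup generated by $S$ and $\lim_{n\to\infty}|f^n|_S/n=0$, where $|\cdot|_S$ is the word length with respect to $S$ and inverses of elements of $S$. Let $z_0\ne z_1$ be points of $S^2$ and let $\overline{A}$ be the compact annulus obtained from $S^2$ by blowing up $z_0$ and $z_1$ (each is replaced by its circle of unit tangent vectors). Identify the universal covering space of $\overline{A}$ with $\mathbb{R}\times[0,1]$ in such a way that the covering translations are the iterates of $T(x,y)=(x+1,y)$. A *smooth curve* is a curve $[0,1]\to S^2$ of class $C^1$ with nowhere vanishing velocity. Let $\gamma$ be a smooth curve from $z_0$ to $z_1$, and let $\beta$ be a simple closed curve on $S^2$ such that $z_1$ lies in a disk bounded by $\beta$ (that is, $z_1\notin\beta$). For lifts $\check\alpha$ and $\check\gamma$ to $\mathbb{R}\times[0,1]$ of a curve $\alpha$ and of $\gamma$, put $$\check L_{\check\beta,\check\gamma}(\check\alpha)=\max\{0,\,b-a-2\},$$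 where $a+1$ and $b-1$ are the least and the greatest integer $i$ with $\check\alpha\cap T^i(\check\gamma)\neq\emptyset$ (and $\check L_{\check\beta,\check\gamma}(\check\alpha)=0$ if there is no such $i$). Let $L_{\beta,\gamma}(\alpha)\in\{0,1,2,\dots,\infty\}$ be the supremum of these numbers over all lifts; if $\alpha$ runs through $z_0$ or $z_1$ and so has no lift as a whole, the lifts of all arcs of $\alpha$ that can be lifted are taken (in the other cases this makes no difference). The curve $\beta$ is part of the notation only. The *spread* of $\alpha$ with respect to $f$, $\beta$ and $\gamma$ is $$\sigma_{f,\beta,\gamma}(\alpha)=\liminf_{n\to\infty}\frac{L_{\beta,\gamma}(f^n(\alpha))}{n}\in[0,\infty].$$ **Proposition.** Let $f$ be a distortion element of $\mathrm{Diff}^1_0(S^2)$. Then, for all $z_0\neq z_1$, $\beta$ and $\gamma$ as above, $$\sigma_{f,\beta,\gamma}(\alpha)=0$$ for every smooth curve $\alpha$ on $S^2$; and if moreover $f(z_0)=z_0$ and $f(z_1)=z_1$, then the same holds for every continuous curve $\alpha$ in $S^2\setminus\{z_0,z_1\}$. -/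

import Mathlib

open scoped Manifold Topology ContDiff InnerProductSpace ENNReal

noncomputable section

namespace Spread

/-! ### Distortion elements of groups -/

/-- Word length of `g` in the generators `S`: the least length of a word in the elements of `S` and
their inverses that represents `g`. (It is only used for `g` in the subgroup generated by `S`.) -/
def wordLength {G : Type*} [Group G] (S : Set G) (g : G) : ℕ :=
  sInf {k | ∃ l : List G, l.length = k ∧ (∀ x ∈ l, x ∈ S ∨ x⁻¹ ∈ S) ∧ l.prod = g}

/-- `f` is a distortion element of the group `G`. -/
def IsDistortionElement {G : Type*} [Group G] (f : G) : Prop :=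
  ¬ IsOfFinOrder f ∧ ∃ S : Finset G, f ∈ Subgroup.closure (S : Set G) ∧
    Filter.Tendsto (fun n : ℕ => (wordLength (S : Set G) (f ^ n) : ℝ) / n) Filter.atTop (𝓝 0)

/-! ### The group `Diff¹(S²)` and its identity component -/

/-- Euclidean three-space. -/
abbrev E3 := EuclideanSpace ℝ (Fin 3)

/-- The 2-sphere, with the smooth structure that Mathlib gives to unit spheres. -/
abbrev S2 := Metric.sphere (0 : E3) 1

/-- The `C¹` diffeomorphisms of the 2-sphere. -/
abbrev Diff1 := Diffeomorph (𝓡 2) (𝓡 2) S2 S2 1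

/-- Diffeomorphisms form a group under composition. -/
instance : Group Diff1 where
  mul f g := g.trans f
  one := Diffeomorph.refl (𝓡 2) S2 1
  inv f := f.symm
  mul_assoc _ _ _ := rfl
  one_mul _ := Diffeomorph.ext fun _ => rfl
  mul_one _ := Diffeomorph.ext fun _ => rfl
  inv_mul_cancel f := Diffeomorph.ext fun x => f.symm_apply_apply x

theorem mul_apply (f g : Diff1) (x : S2) : (f * g) x = f (g x) := rfl

theorem one_apply (x : S2) : (1 : Diff1) x = x := rfl

/-- The tangent map of a `C¹` diffeomorphism, as a continuous self-map of the tangent bundle. -/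
def tangentMapC (f : Diff1) : C(TangentBundle (𝓡 2) S2, TangentBundle (𝓡 2) S2) :=
  ⟨tangentMap (𝓡 2) (𝓡 2) f, f.contMDiff.continuous_tangentMap le_rfl⟩

/-- The `C¹` topology on `Diff¹(S²)`: uniform convergence of the diffeomorphisms together with their
differentials, i.e. the compact-open topology on tangent maps. -/
instance : TopologicalSpace Diff1 :=
  TopologicalSpace.induced tangentMapC inferInstance

theorem tangentMapC_mul (f g : Diff1) : tangentMapC (f * g) = (tangentMapC f).comp (tangentMapC g) := by
  ext1 p
  exact congrFun (tangentMap_comp (I := 𝓡 2) (I' := 𝓡 2) (I'' := 𝓡 2)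
    (f.mdifferentiable one_ne_zero) (g.mdifferentiable one_ne_zero)) p

theorem continuous_mul_left (f : Diff1) : Continuous (fun g : Diff1 => f * g) := by
  rw [continuous_induced_rng]
  have : tangentMapC ∘ (fun g : Diff1 => f * g) = (tangentMapC f).comp ∘ tangentMapC := by
    funext g
    exact tangentMapC_mul f g
  rw [this]
  exact (ContinuousMap.continuous_postcomp _).comp continuous_induced_dom

theorem mul_mem_component (f : Diff1) {g h : Diff1} (hg : g ∈ connectedComponent h) :
    f * g ∈ connectedComponent (f * h) :=
  (continuous_mul_left f).image_connectedComponent_subset h ⟨g, hg, rfl⟩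

/-- The connected component of the identity in `Diff¹(S²)`. -/
def Diff1Zero : Subgroup Diff1 where
  carrier := connectedComponent 1
  one_mem' := mem_connectedComponent
  mul_mem' {f g} hf hg := by
    have h := mul_mem_component f hg
    rw [mul_one] at h
    rwa [connectedComponent_eq hf, connectedComponent_eq h] at *
  inv_mem' {f} hf := by
    have h := mul_mem_component f⁻¹ hf
    rw [mul_one, inv_mul_cancel] at h
    exact (connectedComponent_eq h).subset mem_connectedComponent

/-! ### The blown-up annulus and its universal covering -/

/-- The compact annulus obtained from the 2-sphere by blowing up the two points `z₀` and `z₁`.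
A point is a triple `(z, u, v)` where `z` is a point of the sphere and `u`, `v` are the directions
(unit vectors of three-space) from `z₀` to `z` and from `z₁` to `z`. At `z = z₀` the direction `u` is
an arbitrary unit tangent vector of the sphere at `z₀`, and similarly at `z₁`; hence `z₀` and `z₁`
are replaced by their circles of unit tangent vectors. -/
def blowUpSet (z₀ z₁ : S2) : Set (S2 × E3 × E3) :=
  {p | (‖p.2.1‖ = 1 ∧ (p.1 : E3) - z₀ = ‖(p.1 : E3) - z₀‖ • p.2.1 ∧
      (p.1 = z₀ → ⟪p.2.1, (z₀ : E3)⟫_ℝ = 0)) ∧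
    (‖p.2.2‖ = 1 ∧ (p.1 : E3) - z₁ = ‖(p.1 : E3) - z₁‖ • p.2.2 ∧
      (p.1 = z₁ → ⟪p.2.2, (z₁ : E3)⟫_ℝ = 0))}

/-- The blown-up annulus as a topological space, with the subspace topology. -/
abbrev BlowUp (z₀ z₁ : S2) : Type := blowUpSet z₀ z₁

/-- The blow-down map from the blown-up annulus to the sphere. -/
def blowDown {z₀ z₁ : S2} (p : BlowUp z₀ z₁) : S2 := p.1.1

/-- The strip `ℝ × [0,1]`. -/
abbrev Strip := ℝ × unitInterval

/-- The `i`-th iterate `Tⁱ` of the translation `T (x, y) = (x + 1, y)`. -/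
def translate (i : ℤ) (p : Strip) : Strip := (p.1 + i, p.2)

/-- `π` identifies `ℝ × [0,1]` with the universal covering space of the annulus obtained by blowing up
`z₀` and `z₁`, in such a way that the covering translations are the iterates of `T`. -/
structure IsUniversalCover (z₀ z₁ : S2) (π : Strip → BlowUp z₀ z₁) : Prop where
  isCoveringMap : IsCoveringMap π
  surjective : Function.Surjective π
  apply_eq_iff : ∀ p q, π p = π q ↔ ∃ i : ℤ, q = translate i p

/-! Such identifications exist: an explicit one comes from the inversion with centre `z₁` that fixes
`z₀`, which maps the sphere minus `z₁` to the plane through `z₀` parallel to the tangent plane at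
`z₁`. -/

section Existence

theorem norm_S2 (z : S2) : ‖(z : E3)‖ = 1 := by
  have := z.2
  rwa [mem_sphere_zero_iff_norm] at this

theorem inner_sub_left_S2 (z w : S2) : ⟪(z : E3) - w, (w : E3)⟫_ℝ = -‖(z : E3) - w‖ ^ 2 / 2 := by
  rw [norm_sub_sq_real, inner_sub_left, real_inner_self_eq_norm_sq, norm_S2, norm_S2]
  ring

theorem exists_tangentFrame (z : S2) :
    ∃ L : ℂ →ₗᵢ[ℝ] E3, ∀ w : E3, (∃ c, L c = w) ↔ ⟪w, (z : E3)⟫_ℝ = 0 := by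
  have hz : (z : E3) ≠ 0 := by
    intro h; have := norm_S2 z; simp [h] at this
  have : Fact (Module.finrank ℝ E3 = 2 + 1) := ⟨by simp⟩
  have h2 : Module.finrank ℝ (Submodule.span ℝ {(z : E3)})ᗮ = 2 :=
    Submodule.finrank_orthogonal_span_singleton hz
  let e : ℂ ≃ₗᵢ[ℝ] (Submodule.span ℝ {(z : E3)})ᗮ :=
    Complex.orthonormalBasisOneI.equiv ((stdOrthonormalBasis ℝ _).reindex (finCongr h2)) (Equiv.refl _)
  refine ⟨(Submodule.subtypeₗᵢ _).comp e.toLinearIsometry, fun w => ?_⟩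
  rw [real_inner_comm, ← Submodule.mem_orthogonal_singleton_iff_inner_right]
  constructor
  · rintro ⟨c, rfl⟩
    exact (e c).2
  · intro h
    exact ⟨e.symm ⟨w, h⟩, by simp⟩

def qVec (c f : E3) (h : ℝ) : E3 := (1 - h) • c + h • f

def mVec (c f : E3) (h : ℝ) : E3 := (‖c‖ ^ 2 * (1 - h)) • f - (2 * (1 - h) * ⟪c, f⟫_ℝ + h) • c

theorem norm_qVec_sq (c f : E3) (hf : ‖f‖ = 1) (h : ℝ) :
    ‖qVec c f h‖ ^ 2 = (1 - h) ^ 2 * ‖c‖ ^ 2 + 2 * h * (1 - h) * ⟪c, f⟫_ℝ + h ^ 2 := by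
  rw [qVec, norm_add_sq_real, norm_smul, norm_smul, mul_pow, mul_pow, hf, inner_smul_left,
    inner_smul_right]
  simp
  ring

theorem norm_mVec_sq (c f : E3) (hf : ‖f‖ = 1) (h : ℝ) :
    ‖mVec c f h‖ ^ 2 = ‖c‖ ^ 2 * ‖qVec c f h‖ ^ 2 := by
  rw [norm_qVec_sq c f hf, mVec, norm_sub_sq_real, norm_smul, norm_smul, mul_pow, mul_pow, hf,
    inner_smul_left, inner_smul_right, real_inner_comm]
  simp only [Real.norm_eq_abs, sq_abs, conj_trivial]
  ring

theorem mVec_eq (c f : E3) (hf : ‖f‖ = 1) (h : ℝ) :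
    (‖c‖ ^ 2 * (1 - h)) • qVec c f h - ‖qVec c f h‖ ^ 2 • c = h • mVec c f h := by
  rw [norm_qVec_sq c f hf, mVec, qVec]
  module

theorem coe_mem_Icc (h : unitInterval) : 0 ≤ (h : ℝ) ∧ (h : ℝ) ≤ 1 := h.2

variable {z₀ z₁ : S2}

theorem inner_qVec {f : E3} (hfz : ⟪f, (z₁ : E3)⟫_ℝ = 0) (h : ℝ) :
    ⟪qVec ((z₀ : E3) - z₁) f h, (z₁ : E3)⟫_ℝ = -(1 - h) * ‖(z₀ : E3) - z₁‖ ^ 2 / 2 := by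
  rw [qVec, inner_add_left, inner_smul_left, inner_smul_left, hfz, inner_sub_left_S2]
  simp
  ring

theorem norm_c_pos (hz : z₀ ≠ z₁) : 0 < ‖(z₀ : E3) - z₁‖ :=
  norm_pos_iff.2 (sub_ne_zero.2 fun h => hz (Subtype.ext h))

theorem norm_qVec_pos (hz : z₀ ≠ z₁) {f : E3} (hf : ‖f‖ = 1) (hfz : ⟪f, (z₁ : E3)⟫_ℝ = 0)
    (h : ℝ) : 0 < ‖qVec ((z₀ : E3) - z₁) f h‖ := by
  rw [norm_pos_iff]
  intro h0
  have h1 := inner_qVec (z₀ := z₀) hfz h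
  rw [h0, inner_zero_left] at h1
  have hc := norm_c_pos hz
  have h2 : h = 1 := by
    have : (1 - h) * ‖(z₀ : E3) - z₁‖ ^ 2 = 0 := by linarith
    rcases mul_eq_zero.1 this with h3 | h3
    · linarith
    · exact absurd h3 (by positivity)
  rw [qVec, h2] at h0
  simp at h0
  simp [h0] at hf

theorem annulus_point_mem (hz : z₀ ≠ z₁) {f : E3} (hf : ‖f‖ = 1) (hfz : ⟪f, (z₁ : E3)⟫_ℝ = 0)
    (h : ℝ) : (z₁ : E3) + (‖(z₀ : E3) - z₁‖ ^ 2 * (1 - h) / ‖qVec ((z₀ : E3) - z₁) f h‖ ^ 2) •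
      qVec ((z₀ : E3) - z₁) f h ∈ Metric.sphere (0 : E3) 1 := by
  have hq := norm_qVec_pos hz hf hfz h
  rw [mem_sphere_zero_iff_norm, ← sq_eq_sq₀ (norm_nonneg _) zero_le_one, norm_add_sq_real,
    inner_smul_right, real_inner_comm, inner_qVec hfz, norm_S2, norm_smul, mul_pow,
    Real.norm_eq_abs, sq_abs]
  field_simp
  ring

/-- The point of the blown-up annulus with angular coordinate `f` and radial coordinate `h`. -/
def annulusPoint (hz : z₀ ≠ z₁) (f : E3) (hf : ‖f‖ = 1) (hfz : ⟪f, (z₁ : E3)⟫_ℝ = 0)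
    (h : unitInterval) : S2 × E3 × E3 :=
  (⟨_, annulus_point_mem hz hf hfz h⟩,
    (1 / (‖(z₀ : E3) - z₁‖ * ‖qVec ((z₀ : E3) - z₁) f h‖)) • mVec ((z₀ : E3) - z₁) f h,
    (1 / ‖qVec ((z₀ : E3) - z₁) f h‖) • qVec ((z₀ : E3) - z₁) f h)

theorem norm_mVec (c f : E3) (hf : ‖f‖ = 1) (h : ℝ) : ‖mVec c f h‖ = ‖c‖ * ‖qVec c f h‖ := by
  rw [← sq_eq_sq₀ (norm_nonneg _) (by positivity), norm_mVec_sq c f hf, mul_pow]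

section

variable (hz : z₀ ≠ z₁) {f : E3} (hf : ‖f‖ = 1) (hfz : ⟪f, (z₁ : E3)⟫_ℝ = 0) (h : unitInterval)

theorem annulusPoint_sub_one : ((annulusPoint hz f hf hfz h).1 : E3) - z₁ =
    (‖(z₀ : E3) - z₁‖ ^ 2 * (1 - h) / ‖qVec ((z₀ : E3) - z₁) f h‖) •
      (annulusPoint hz f hf hfz h).2.2 := by
  have hq := norm_qVec_pos hz hf hfz h
  simp only [annulusPoint, smul_smul, add_sub_cancel_left]
  congr 1
  field_simp

theorem annulusPoint_sub_zero : ((annulusPoint hz f hf hfz h).1 : E3) - z₀ =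
    (h * ‖(z₀ : E3) - z₁‖ / ‖qVec ((z₀ : E3) - z₁) f h‖) •
      (annulusPoint hz f hf hfz h).2.1 := by
  have hq := norm_qVec_pos hz hf hfz h
  have hc := norm_c_pos hz
  have key := mVec_eq ((z₀ : E3) - z₁) f hf h
  simp only [annulusPoint, smul_smul]
  have e1 : h * ‖(z₀ : E3) - z₁‖ / ‖qVec ((z₀ : E3) - z₁) f h‖ *
      (1 / (‖(z₀ : E3) - z₁‖ * ‖qVec ((z₀ : E3) - z₁) f h‖)) =
      (1 / ‖qVec ((z₀ : E3) - z₁) f h‖ ^ 2) * h := by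
    field_simp
  rw [e1, mul_smul, ← key, smul_sub, smul_smul, smul_smul]
  have e2 : 1 / ‖qVec ((z₀ : E3) - z₁) f h‖ ^ 2 * ‖qVec ((z₀ : E3) - z₁) f h‖ ^ 2 = 1 := by
    field_simp
  rw [e2, one_smul, div_mul_eq_mul_div, one_mul]
  abel

theorem norm_annulusPoint_u : ‖(annulusPoint hz f hf hfz h).2.1‖ = 1 := by
  have hq := norm_qVec_pos hz hf hfz h
  have hc := norm_c_pos hz
  simp only [annulusPoint, norm_smul, norm_mVec _ f hf]
  rw [Real.norm_of_nonneg (by positivity)]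
  field_simp

theorem norm_annulusPoint_v : ‖(annulusPoint hz f hf hfz h).2.2‖ = 1 := by
  have hq := norm_qVec_pos hz hf hfz h
  simp only [annulusPoint, norm_smul]
  rw [Real.norm_of_nonneg (by positivity)]
  field_simp

theorem dist_annulusPoint_zero : ‖((annulusPoint hz f hf hfz h).1 : E3) - z₀‖ =
    h * ‖(z₀ : E3) - z₁‖ / ‖qVec ((z₀ : E3) - z₁) f h‖ := by
  have hh := coe_mem_Icc h
  rw [annulusPoint_sub_zero, norm_smul, norm_annulusPoint_u, mul_one,
    Real.norm_of_nonneg (div_nonneg (mul_nonneg hh.1 (norm_nonneg _)) (norm_nonneg _))]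

theorem dist_annulusPoint_one : ‖((annulusPoint hz f hf hfz h).1 : E3) - z₁‖ =
    ‖(z₀ : E3) - z₁‖ ^ 2 * (1 - h) / ‖qVec ((z₀ : E3) - z₁) f h‖ := by
  have hh := coe_mem_Icc h
  rw [annulusPoint_sub_one, norm_smul, norm_annulusPoint_v, mul_one,
    Real.norm_of_nonneg (div_nonneg (mul_nonneg (by positivity) (by linarith)) (norm_nonneg _))]

theorem annulusPoint_mem : annulusPoint hz f hf hfz h ∈ blowUpSet z₀ z₁ := by
  have hq := norm_qVec_pos hz hf hfz h
  have hc := norm_c_pos hz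
  refine ⟨⟨norm_annulusPoint_u .., ?_, fun h0 => ?_⟩, norm_annulusPoint_v .., ?_, fun h1 => ?_⟩
  · rw [dist_annulusPoint_zero]; exact annulusPoint_sub_zero ..
  · have := dist_annulusPoint_zero hz hf hfz h
    rw [h0, sub_self, norm_zero, eq_comm, div_eq_zero_iff] at this
    have hh : (h : ℝ) = 0 := by
      rcases this with h2 | h2
      · rcases mul_eq_zero.1 h2 with h3 | h3
        · exact h3
        · exact absurd h3 hc.ne'
      · exact absurd h2 hq.ne'
    have hfa : ⟪f, (z₀ : E3)⟫_ℝ = ⟪(z₀ : E3) - z₁, f⟫_ℝ := by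
      rw [inner_sub_left, real_inner_comm f (z₁ : E3), hfz, sub_zero, real_inner_comm]
    have hca : ⟪(z₀ : E3) - z₁, (z₀ : E3)⟫_ℝ = ‖(z₀ : E3) - z₁‖ ^ 2 / 2 := by
      have := inner_sub_left_S2 z₁ z₀
      rw [norm_sub_rev, ← neg_sub, inner_neg_left] at this
      linarith
    simp only [annulusPoint, mVec, hh, inner_smul_left, inner_sub_left _ _ (z₀ : E3), hfa]
    rw [← inner_sub_left, hca]
    simp only [conj_trivial]
    ring
  · rw [dist_annulusPoint_one]; exact annulusPoint_sub_one ..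
  · have := dist_annulusPoint_one hz hf hfz h
    rw [h1, sub_self, norm_zero, eq_comm, div_eq_zero_iff] at this
    have hh : (h : ℝ) = 1 := by
      rcases this with h2 | h2
      · rcases mul_eq_zero.1 h2 with h3 | h3
        · exact absurd h3 (by positivity)
        · linarith
      · exact absurd h2 hq.ne'
    simp [annulusPoint, qVec, hh, inner_smul_left, hfz]

end

theorem annulusPoint_injective (hz : z₀ ≠ z₁) {f f' : E3} (hf : ‖f‖ = 1)
    (hfz : ⟪f, (z₁ : E3)⟫_ℝ = 0) (hf' : ‖f'‖ = 1) (hfz' : ⟪f', (z₁ : E3)⟫_ℝ = 0)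
    {h h' : unitInterval} (e : annulusPoint hz f hf hfz h = annulusPoint hz f' hf' hfz' h') :
    f = f' ∧ h = h' := by
  have hq := norm_qVec_pos hz hf hfz h
  have hq' := norm_qVec_pos hz hf' hfz' h'
  have hc := norm_c_pos hz
  have d0 := dist_annulusPoint_zero hz hf hfz h
  have d1 := dist_annulusPoint_one hz hf hfz h
  rw [e, dist_annulusPoint_zero] at d0
  rw [e, dist_annulusPoint_one] at d1
  have e3 := congrArg (fun p => p.2.1) e
  have e4 := congrArg (fun p => p.2.2) e
  simp only [annulusPoint] at e3 e4
  set c := (z₀ : E3) - z₁ with hcdef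
  have hQ : ‖qVec c f' h'‖ = ‖qVec c f h‖ := by
    rw [div_eq_div_iff hq'.ne' hq.ne'] at d0 d1
    have t0 : (h' : ℝ) * ‖qVec c f h‖ = h * ‖qVec c f' h'‖ := by
      apply mul_left_cancel₀ hc.ne'; linarith
    have t1 : (1 - (h' : ℝ)) * ‖qVec c f h‖ = (1 - h) * ‖qVec c f' h'‖ := by
      apply mul_left_cancel₀ (pow_pos hc 2).ne'; linarith
    linarith
  rw [hQ] at d0 d1 e3 e4
  have hh : (h : ℝ) = h' := by
    rw [div_left_inj' hq.ne'] at d0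
    exact (mul_right_cancel₀ hc.ne' d0).symm
  have e3' : mVec c f h = mVec c f' h' := smul_right_injective E3 (by positivity) e3
  have e4' : qVec c f h = qVec c f' h' := smul_right_injective E3 (by positivity) e4
  refine ⟨?_, Subtype.ext hh⟩
  rw [← hh] at e3' e4'
  by_cases h0 : (h : ℝ) = 0
  · rw [h0] at e3'
    simp only [mVec, sub_zero, mul_one, add_zero] at e3'
    have hk : ⟪c, f⟫_ℝ = ⟪c, f'⟫_ℝ := by
      have := congrArg (fun w => ⟪c, w⟫_ℝ) e3'
      simp only [inner_sub_right, inner_smul_right, real_inner_self_eq_norm_sq] at this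
      have h2 : ‖c‖ ^ 2 * ⟪c, f⟫_ℝ = ‖c‖ ^ 2 * ⟪c, f'⟫_ℝ := by linarith
      exact mul_left_cancel₀ (by positivity) h2
    rw [hk] at e3'
    exact smul_right_injective E3 (by positivity) (sub_left_injective e3')
  · simp only [qVec] at e4'
    exact smul_right_injective E3 h0 (add_left_cancel e4')

theorem blowUp_ext {p p' : S2 × E3 × E3} (hp : p ∈ blowUpSet z₀ z₁)
    (hp' : p' ∈ blowUpSet z₀ z₁) (e : p.1 = p'.1) (e0 : p.1 = z₀ → p.2.1 = p'.2.1)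
    (e1 : p.1 = z₁ → p.2.2 = p'.2.2) : p = p' := by
  refine Prod.ext e (Prod.ext ?_ ?_)
  · by_cases h : p.1 = z₀
    · exact e0 h
    · have h1 := hp.1.2.1
      have h2 := hp'.1.2.1
      rw [← e] at h2
      exact smul_right_injective E3 (norm_c_pos h).ne' (h1.symm.trans h2)
  · by_cases h : p.1 = z₁
    · exact e1 h
    · have h1 := hp.2.2.1
      have h2 := hp'.2.2.1
      rw [← e] at h2
      exact smul_right_injective E3 (norm_c_pos h).ne' (h1.symm.trans h2)

theorem annulusPoint_surjective (hz : z₀ ≠ z₁) {p : S2 × E3 × E3} (hp : p ∈ blowUpSet z₀ z₁) :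
    ∃ (f : E3) (hf : ‖f‖ = 1) (hfz : ⟪f, (z₁ : E3)⟫_ℝ = 0) (h : unitInterval),
      annulusPoint hz f hf hfz h = p := by
  obtain ⟨z, u, v⟩ := p
  obtain ⟨⟨hu, huz, hu0⟩, hv, hvz, hv1⟩ := hp
  simp only at hu huz hu0 hv hvz hv1
  have hc := norm_c_pos hz
  set c := (z₀ : E3) - z₁ with hcdef
  have hcz : ⟪c, (z₁ : E3)⟫_ℝ = -‖c‖ ^ 2 / 2 := inner_sub_left_S2 z₀ z₁
  by_cases h0 : z = z₀
  · subst h0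
    have hu0 := hu0 rfl
    have hf : ‖u - (2 * ⟪c, u⟫_ℝ / ‖c‖ ^ 2) • c‖ = 1 := by
      rw [← sq_eq_sq₀ (norm_nonneg _) zero_le_one, norm_sub_sq_real, norm_smul, mul_pow, hu,
        inner_smul_right, Real.norm_eq_abs, sq_abs, real_inner_comm]
      field_simp
      ring
    have hfz : ⟪u - (2 * ⟪c, u⟫_ℝ / ‖c‖ ^ 2) • c, (z₁ : E3)⟫_ℝ = 0 := by
      have : ⟪c, u⟫_ℝ = - ⟪u, (z₁ : E3)⟫_ℝ := by
        rw [hcdef, real_inner_comm, inner_sub_right, hu0, zero_sub]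
      rw [inner_sub_left, inner_smul_left, hcz, this]
      simp only [conj_trivial]
      field_simp
      ring
    refine ⟨_, hf, hfz, 0, blowUp_ext (annulusPoint_mem ..)
      ⟨⟨hu, huz, fun _ => hu0⟩, hv, hvz, hv1⟩ ?_ ?_ ?_⟩
    · apply Subtype.ext
      have := dist_annulusPoint_zero hz hf hfz 0
      simp only [Set.Icc.coe_zero, zero_mul, zero_div, norm_eq_zero] at this
      exact sub_eq_zero.1 this
    · intro _
      simp only [annulusPoint, mVec, qVec, Set.Icc.coe_zero, sub_zero, one_smul, zero_smul, add_zero,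
        mul_one, ← hcdef, inner_sub_right, inner_smul_right, real_inner_self_eq_norm_sq]
      rw [div_mul_cancel₀ _ (by positivity), smul_sub, smul_smul, smul_sub,
        smul_smul, smul_smul, sub_sub, ← add_smul]
      have e1 : 1 / (‖c‖ * ‖c‖) * ‖c‖ ^ 2 = 1 := by field_simp
      have e2 : 2 * ⟪c, u⟫_ℝ / ‖c‖ ^ 2 +
          1 / (‖c‖ * ‖c‖) * 2 * (⟪c, u⟫_ℝ - 2 * ⟪c, u⟫_ℝ) = 0 := by
        field_simp
        ring
      rw [e1, one_mul, ← mul_assoc, e2, zero_smul, one_smul, sub_zero]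
    · intro h1
      exfalso
      have := dist_annulusPoint_zero hz hf hfz 0
      rw [h1] at this
      simp only [Set.Icc.coe_zero, zero_mul, zero_div, norm_eq_zero] at this
      exact hz (Subtype.ext (sub_eq_zero.1 this).symm)
  · have hA0 : 0 < ‖(z : E3) - z₀‖ := norm_c_pos h0
    have hA1 : 0 ≤ ‖(z : E3) - z₁‖ := norm_nonneg _
    have hvz1 : ⟪v, (z₁ : E3)⟫_ℝ = -‖(z : E3) - z₁‖ / 2 := by
      by_cases h1 : z = z₁
      · rw [hv1 h1, h1]; simp
      · have h2 := inner_sub_left_S2 z z₁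
        rw [hvz, inner_smul_left, norm_smul, hv] at h2
        simp only [conj_trivial, mul_one, norm_norm] at h2
        apply mul_left_cancel₀ (norm_c_pos h1).ne'
        rw [h2]; ring
    have hvc : 2 * (‖(z : E3) - z₁‖ * ⟪v, c⟫_ℝ) =
        ‖(z : E3) - z₁‖ ^ 2 + ‖c‖ ^ 2 - ‖(z : E3) - z₀‖ ^ 2 := by
      have h2 : (z : E3) - z₀ = ((z : E3) - z₁) - c := by rw [hcdef]; abel
      have h3 : ‖(z : E3) - z₁‖ * ⟪v, c⟫_ℝ = ⟪(z : E3) - z₁, c⟫_ℝ := by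
        conv_rhs => rw [hvz, inner_smul_left]
        simp
      rw [h3, h2, norm_sub_sq_real ((z : E3) - z₁) c]
      ring
    set A0 := ‖(z : E3) - z₀‖
    set A1 := ‖(z : E3) - z₁‖
    have hs : 0 < A0 + A1 / ‖c‖ := by positivity
    set s := A0 + A1 / ‖c‖ with hsdef
    have hh1 : 1 - A0 / s = A1 / (‖c‖ * s) := by
      rw [eq_div_iff (by positivity), hsdef]; field_simp; ring
    have hmem : A0 / s ∈ Set.Icc (0 : ℝ) 1 := by
      refine ⟨by positivity, ?_⟩
      have : 0 ≤ A1 / (‖c‖ * s) := by positivity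
      linarith
    have hf : ‖(s / A0) • ((‖c‖ / s) • v - (1 - A0 / s) • c)‖ = 1 := by
      rw [← sq_eq_sq₀ (norm_nonneg _) zero_le_one, norm_smul, mul_pow, norm_sub_sq_real, norm_smul,
        norm_smul, mul_pow, mul_pow, hv, inner_smul_right, inner_smul_left, Real.norm_eq_abs, sq_abs,
        Real.norm_eq_abs, sq_abs, Real.norm_eq_abs, sq_abs, hh1]
      simp only [conj_trivial]
      field_simp
      linarith
    have hfz : ⟪(s / A0) • ((‖c‖ / s) • v - (1 - A0 / s) • c), (z₁ : E3)⟫_ℝ = 0 := by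
      rw [inner_smul_left, inner_sub_left, inner_smul_left, inner_smul_left, hvz1, hcz, hh1]
      simp only [conj_trivial]
      field_simp
      ring
    have hq : qVec c ((s / A0) • ((‖c‖ / s) • v - (1 - A0 / s) • c)) (A0 / s) = (‖c‖ / s) • v := by
      rw [qVec, smul_smul]
      have : A0 / s * (s / A0) = 1 := by field_simp
      rw [this, one_smul]
      abel
    have hqn : ‖(‖c‖ / s) • v‖ = ‖c‖ / s := by
      rw [norm_smul, hv, mul_one, Real.norm_of_nonneg (by positivity)]
    have hpt : (annulusPoint hz _ hf hfz ⟨A0 / s, hmem⟩).1 = z := by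
      apply Subtype.ext
      simp only [annulusPoint, ← hcdef]
      rw [hq, hqn, smul_smul, hh1]
      have : ‖c‖ ^ 2 * (A1 / (‖c‖ * s)) / (‖c‖ / s) ^ 2 * (‖c‖ / s) = A1 := by field_simp
      rw [this, ← hvz]
      abel
    refine ⟨_, hf, hfz, ⟨A0 / s, hmem⟩, blowUp_ext (annulusPoint_mem ..)
      ⟨⟨hu, huz, hu0⟩, hv, hvz, hv1⟩ hpt ?_ ?_⟩
    · intro h1
      exact absurd (hpt.symm.trans h1) h0
    · intro _
      simp only [annulusPoint, ← hcdef]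
      rw [hq, hqn, smul_smul]
      have : 1 / (‖c‖ / s) * (‖c‖ / s) = 1 := by field_simp
      rw [this, one_smul]

/-- The covering translations as an action of the integers. -/
@[reducible] def stripAction : AddAction ℤ Strip where
  vadd i p := translate i p
  zero_vadd p := by
    change translate 0 p = p
    simp [translate]
  add_vadd i j p := by
    change translate (i + j) p = translate i (translate j p)
    simp only [translate, Int.cast_add, Prod.mk.injEq, and_true]
    ring

theorem isCoveringMap_of_fibers {X : Type*} [TopologicalSpace X] [T2Space X] {π : Strip → X}
    (hc : Continuous π) (hs : Function.Surjective π)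
    (hfib : ∀ p q, π p = π q ↔ ∃ i : ℤ, q = translate i p) : IsCoveringMap π := by
  let := stripAction
  have hquot : Topology.IsQuotientMap π := by
    let K : Set Strip := Set.Icc (0 : ℝ) 1 ×ˢ Set.univ
    have hK : IsCompact K := isCompact_Icc.prod isCompact_univ
    have : CompactSpace K := isCompact_iff_compactSpace.1 hK
    have hsK : Function.Surjective (π ∘ ((↑) : K → Strip)) := by
      intro x
      obtain ⟨p, rfl⟩ := hs x
      refine ⟨⟨translate (-⌊p.1⌋) p, ?_, trivial⟩, ((hfib _ _).2 ⟨-⌊p.1⌋, rfl⟩).symm⟩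
      have h1 := Int.floor_le p.1
      have h2 := Int.lt_floor_add_one p.1
      simp only [translate, Int.cast_neg]
      constructor <;> linarith
    have hcK : Continuous (π ∘ ((↑) : K → Strip)) := hc.comp continuous_subtype_val
    exact Topology.IsQuotientMap.of_comp continuous_subtype_val hc
      (hcK.isClosedMap.isQuotientMap hcK hsK)
  have : IsAddQuotientCoveringMap π ℤ :=
    { hquot with
      continuous_const_vadd := fun i => by
        change Continuous (fun p : Strip => translate i p)
        unfold translate
        fun_prop
      apply_eq_iff_mem_orbit := by
        intro p q
        rw [eq_comm, hfib]
        exact ⟨fun ⟨i, hi⟩ => ⟨i, hi.symm⟩, fun ⟨i, hi⟩ => ⟨i, hi.symm⟩⟩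
      disjoint := by
        intro p
        refine ⟨Metric.ball p.1 (1 / 2) ×ˢ Set.univ,
          prod_mem_nhds (Metric.ball_mem_nhds _ (by norm_num)) Filter.univ_mem, ?_⟩
        rintro i ⟨_, ⟨q, hq, rfl⟩, hq'⟩
        have h1 : |q.1 - p.1| < 1 / 2 := hq.1
        have h2 : |q.1 + i - p.1| < 1 / 2 := hq'.1
        rw [abs_lt] at h1 h2
        have h3 : (i : ℝ) < 1 := by linarith
        have h4 : (-1 : ℝ) < i := by linarith
        have h5 : i < 1 := by exact_mod_cast h3
        have h6 : -1 < i := by exact_mod_cast h4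
        omega }
  exact this.isCoveringMap

theorem exists_isUniversalCover (hz : z₀ ≠ z₁) :
    ∃ π : Strip → BlowUp z₀ z₁, IsUniversalCover z₀ z₁ π := by
  obtain ⟨L, hL⟩ := exists_tangentFrame z₁
  let F : ℝ → E3 := fun x => L (Circle.exp (2 * Real.pi * x) : ℂ)
  have hF : ∀ x, ‖F x‖ = 1 := fun x => by rw [L.norm_map]; exact Circle.norm_coe _
  have hFz : ∀ x, ⟪F x, (z₁ : E3)⟫_ℝ = 0 := fun x => (hL _).1 ⟨_, rfl⟩
  have hFc : Continuous F := L.continuous.comp (by fun_prop)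
  have hFinj : ∀ x y, F x = F y ↔ ∃ i : ℤ, y = x + i := by
    intro x y
    have : F x = F y ↔ Circle.exp (2 * Real.pi * y) = Circle.exp (2 * Real.pi * x) := by
      rw [L.injective.eq_iff, Circle.coe_inj, eq_comm]
    rw [this, Circle.exp_eq_exp]
    refine exists_congr fun i => ⟨fun h => ?_, fun h => ?_⟩
    · apply mul_left_cancel₀ Real.two_pi_pos.ne'
      linarith
    · rw [h]; ring
  have hFsurj : ∀ w : E3, ‖w‖ = 1 → ⟪w, (z₁ : E3)⟫_ℝ = 0 → ∃ x, F x = w := by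
    intro w hw hwz
    obtain ⟨c, rfl⟩ := (hL w).2 hwz
    rw [L.norm_map] at hw
    obtain ⟨t, ht⟩ : ∃ t, Circle.exp t = ⟨c, mem_sphere_zero_iff_norm.2 hw⟩ := ⟨_, Circle.exp_arg _⟩
    refine ⟨t / (2 * Real.pi), ?_⟩
    simp only [F]
    rw [mul_div_cancel₀ _ Real.two_pi_pos.ne', ht]
  let π : Strip → BlowUp z₀ z₁ := fun p =>
    ⟨annulusPoint hz (F p.1) (hF _) (hFz _) p.2, annulusPoint_mem ..⟩
  have hq : ∀ p : Strip, ‖qVec ((z₀ : E3) - z₁) (F p.1) p.2‖ ≠ 0 :=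
    fun p => (norm_qVec_pos hz (hF _) (hFz _) _).ne'
  have hc := (norm_c_pos hz).ne'
  have hqc : Continuous fun p : Strip => qVec ((z₀ : E3) - z₁) (F p.1) p.2 := by
    unfold qVec; fun_prop
  have hmc : Continuous fun p : Strip => mVec ((z₀ : E3) - z₁) (F p.1) p.2 := by
    unfold mVec; fun_prop
  have hπc : Continuous π := by
    refine Continuous.subtype_mk (Continuous.prodMk (Continuous.subtype_mk ?_ _)
      (Continuous.prodMk ?_ ?_)) _
    · exact continuous_const.add (((by fun_prop : Continuous fun p : Strip =>
        ‖(z₀ : E3) - z₁‖ ^ 2 * (1 - (p.2 : ℝ))).div (hqc.norm.pow 2)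
          fun p => pow_ne_zero 2 (hq p)).smul hqc)
    · exact (continuous_const.div (continuous_const.mul hqc.norm)
        fun p => mul_ne_zero hc (hq p)).smul hmc
    · exact (continuous_const.div hqc.norm hq).smul hqc
  have hπs : Function.Surjective π := by
    rintro ⟨p, hp⟩
    obtain ⟨f, hf, hfz, h, rfl⟩ := annulusPoint_surjective hz hp
    obtain ⟨x, rfl⟩ := hFsurj f hf hfz
    exact ⟨(x, h), rfl⟩
  have hfib : ∀ p q, π p = π q ↔ ∃ i : ℤ, q = translate i p := by
    intro p q
    constructor
    · intro h
      have h' := annulusPoint_injective hz (hF _) (hFz _) (hF _) (hFz _) (congrArg Subtype.val h)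
      obtain ⟨i, hi⟩ := (hFinj _ _).1 h'.1
      exact ⟨i, Prod.ext hi h'.2.symm⟩
    · rintro ⟨i, rfl⟩
      have h1 : F p.1 = F (translate i p).1 := (hFinj _ _).2 ⟨i, rfl⟩
      apply Subtype.ext
      simp only [π]
      congr 1
  exact ⟨π, isCoveringMap_of_fibers hπc hπs hfib, hπs, hfib⟩

end Existence

/-! ### Spread -/

/-- A smooth curve on the sphere, parametrized by `[0,1]`: a `C¹` curve with nowhere vanishing
velocity (the values of the function outside `[0,1]` are irrelevant). -/
def IsSmoothCurve (α : ℝ → S2) : Prop :=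
  ContDiffOn ℝ 1 (fun t => (α t : E3)) (Set.Icc 0 1) ∧
    ∀ t ∈ Set.Icc (0 : ℝ) 1, derivWithin (fun t => (α t : E3)) (Set.Icc 0 1) t ≠ 0

/-- `l` is a lift to the strip, through `π` and the blow-down map, of the arc of the curve `δ` that is
parametrized by `[s,t]`. -/
def IsLift {z₀ z₁ : S2} (π : Strip → BlowUp z₀ z₁) (δ : ℝ → S2) (s t : ℝ) (l : ℝ → Strip) : Prop :=
  ContinuousOn l (Set.Icc s t) ∧ ∀ r ∈ Set.Icc s t, blowDown (π (l r)) = δ r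

/-- The integers `i` for which `A` meets `Tⁱ(C)`. -/
def crossings (A C : Set Strip) : Set ℤ := {i | (A ∩ translate i '' C).Nonempty}

/-- The number `max {0, b - a - 2}` where `a < i < b` is the range of the `i` for which `A` meets
`Tⁱ(C)`. As `a + 1` and `b - 1` are the least and the greatest such `i`, this is the greatest
difference `j - i` of two of them, and `0` if there is none. -/
def liftedSpread (A C : Set Strip) : ℕ∞ :=
  ⨆ (i ∈ crossings A C) (j ∈ crossings A C), ((j - i).toNat : ℕ∞)

/-- The number `L_{β,γ}(δ)`: the maximum of `liftedSpread` over the lifts of `γ` and of `δ`.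
If `δ` avoids `z₀` and `z₁`, or meets them at its endpoints only, it has lifts as a whole and the
maximum is attained by these; if it runs through `z₀` or `z₁` then its arcs that can be lifted are
taken. The closed curve `β` is part of the data, but the value does not depend on it. -/
def curveSpread {z₀ z₁ : S2} (π : Strip → BlowUp z₀ z₁) (_β : Circle → S2) (γ δ : ℝ → S2) : ℕ∞ :=
  ⨆ (g : ℝ → Strip) (_ : IsLift π γ 0 1 g) (s : ℝ) (t : ℝ) (_ : 0 ≤ s ∧ s ≤ t ∧ t ≤ 1)
    (d : ℝ → Strip) (_ : IsLift π δ s t d),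
    liftedSpread (d '' Set.Icc s t) (g '' Set.Icc 0 1)

/-- The spread `σ_{f,β,γ}(α) = liminf L_{β,γ}(fⁿ(α)) / n`, in `[0,∞]`. -/
def spread {z₀ z₁ : S2} (π : Strip → BlowUp z₀ z₁) (f : Diff1) (β : Circle → S2) (γ α : ℝ → S2) :
    ℝ≥0∞ :=
  Filter.liminf (fun n : ℕ =>
    ((curveSpread π β γ (fun t => (f ^ n) (α t)) : ℕ∞) : ℝ≥0∞) / (n : ℝ≥0∞)) Filter.atTop

end Spread

end

/-! The winding of an arc about a pair of points is measured by the argument of `angular x y z`; on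
`CP¹` this is the argument of the quotient `(z - x)/(z - y)`, up to a constant. The central quantity
is the change of this winding when a diffeomorphism `g` moves the arc and both points together. It
is bounded for all arcs and all pairs at once (`AngleBound`), and the bounds add up under
composition.

If `g` is `C¹`-close to the identity, the quotient of `angular (g x) (g y) (g z)` by `angular x y z`
stays in a half-plane as `z` varies (`re_angular_pos`), so the change is below `2π`. Closeness of
difference quotients, and not only of values, is essential here because `z` may be arbitrarily near
`x` or `y`. Thus the diffeomorphisms with a bound form a subgroup containing a neighbourhood of the
identity, hence all of `Diff1Zero`. The bound for `f ^ n` grows at most linearly in its word length,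
which is `o(n)` for a distortion element.

The winding of `f ^ n ∘ α` about `z₀, z₁` is therefore, up to `o(n)`, that of `α` about the
preimages of `z₀, z₁` under `f ^ n`. These move with `n`, but a smooth curve has a winding bound
that holds for all pairs of points (`IsSmoothCurve.exists_turnsAtMost`). When `z₀, z₁` are fixed
there is only one pair, and continuity of `α` suffices.

Finally, the angle extends over the boundary of the blown-up annulus and, on the strip, differs by a
bounded function from a nonzero multiple of the first coordinate (`IsUniversalCover.exists_angle`).
Winding bounds thus bound the widths of lifts, and the number of translates of the lift of `γ` that
are met is controlled by the widths of the two lifts. -/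

/-! ### Continuous arguments of plane curves -/

section PlaneAngle

open ComplexConjugate

/-- `θ` is a continuous determination of the argument of `F` on `[s, t]`. -/
def IsAngleOn (F : ℝ → ℂ) (s t : ℝ) (θ : ℝ → ℝ) : Prop :=
  ContinuousOn θ (Set.Icc s t) ∧ ∀ r ∈ Set.Icc s t, F r = ‖F r‖ * Complex.exp (θ r * Complex.I)

/-- A map from a simply connected space lifts through the covering `exp`; the angle is the imaginary
part of the lift. -/
theorem exists_continuous_angle {A : Type*} [TopologicalSpace A] [SimplyConnectedSpace A]
    [LocallyPathConnectedSpace A] (F : A → ℂ) (hF : Continuous F) (h0 : ∀ a, F a ≠ 0) :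
    ∃ θ : A → ℝ, Continuous θ ∧ ∀ a, F a = ‖F a‖ * Complex.exp (θ a * Complex.I) := by
  obtain ⟨a₀⟩ : Nonempty A := inferInstance
  let G : C(A, {z : ℂ // z ≠ 0}) := ⟨fun a => ⟨F a, h0 a⟩, by fun_prop⟩
  obtain ⟨Λ, ⟨-, hΛ⟩, -⟩ := Complex.isCoveringMap_exp.existsUnique_continuousMap_lifts G a₀
    (Complex.log (F a₀)) (Subtype.ext (Complex.exp_log (h0 a₀)))
  have hexp : ∀ a, Complex.exp (Λ a) = F a := fun a => congrArg Subtype.val (congrFun hΛ a)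
  refine ⟨fun a => (Λ a).im, by fun_prop, fun a => ?_⟩
  rw [← hexp a, Complex.norm_exp, Complex.ofReal_exp, ← Complex.exp_add, Complex.re_add_im]

theorem exists_isAngleOn {F : ℝ → ℂ} {s t : ℝ} (hst : s ≤ t) (hF : ContinuousOn F (Set.Icc s t))
    (h0 : ∀ r ∈ Set.Icc s t, F r ≠ 0) : ∃ θ, IsAngleOn F s t θ := by
  obtain ⟨θ, hθ, h⟩ := exists_continuous_angle (Set.IccExtend hst ((Set.Icc s t).domRestrict F))
    (hF.domRestrict.Icc_extend') (fun r => h0 _ (Set.projIcc s t hst r).2)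
  refine ⟨θ, hθ.continuousOn, fun r hr => ?_⟩
  have := h r
  rwa [Set.IccExtend_of_mem _ _ hr] at this

theorem IsAngleOn.mono {F : ℝ → ℂ} {s t s' t' : ℝ} {θ : ℝ → ℝ} (h : IsAngleOn F s t θ)
    (hs : s ≤ s') (ht : t' ≤ t) : IsAngleOn F s' t' θ :=
  ⟨h.1.mono (Set.Icc_subset_Icc hs ht), fun r hr => h.2 r (Set.Icc_subset_Icc hs ht hr)⟩

/-- An interval of length `2π` contains a representative of `φ` modulo `2π`, which the intermediate
value theorem would make a value of `θ`. -/
theorem abs_sub_lt_two_pi_of_avoid {θ : ℝ → ℝ} {s t φ : ℝ} (hst : s ≤ t)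
    (hθ : ContinuousOn θ (Set.Icc s t))
    (h : ∀ r ∈ Set.Icc s t, Complex.exp (θ r * Complex.I) ≠ Complex.exp (φ * Complex.I)) :
    |θ t - θ s| < 2 * Real.pi := by
  by_contra! hc
  have hpi := Real.two_pi_pos
  obtain ⟨k, hk⟩ : ∃ k : ℤ, φ + k * (2 * Real.pi) ∈ Set.uIcc (θ s) (θ t) := by
    obtain ⟨k, hk, -⟩ := existsUnique_add_zsmul_mem_Ico hpi φ (min (θ s) (θ t))
    refine ⟨k, ?_⟩
    rw [zsmul_eq_mul] at hk
    refine ⟨hk.1, hk.2.le.trans ?_⟩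
    have := max_sub_min_eq_abs (θ s) (θ t)
    change _ ≤ max (θ s) (θ t)
    linarith
  rw [← Set.uIcc_of_le hst] at hθ h
  obtain ⟨r, hr, hr'⟩ := intermediate_value_uIcc hθ hk
  refine h r hr ?_
  rw [hr']
  push_cast
  rw [Complex.exp_eq_exp_iff_exists_int]
  exact ⟨k, by ring⟩

/-- The product `F * conj G` has argument `θ - η` and stays in the open half-plane about its initial
value, so it avoids the opposite direction. -/
theorem IsAngleOn.abs_sub_lt_of_re {F G : ℝ → ℂ} {s t : ℝ} {θ η : ℝ → ℝ} (hst : s ≤ t)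
    (hF : IsAngleOn F s t θ) (hG : IsAngleOn G s t η)
    (h : ∀ r ∈ Set.Icc s t, 0 < (F r * conj (G r) * conj (F s * conj (G s))).re) :
    |(θ t - θ s) - (η t - η s)| < 2 * Real.pi := by
  have h1 := abs_sub_lt_two_pi_of_avoid (θ := fun r => θ r - η r) (φ := θ s - η s + Real.pi) hst
    (hF.1.sub hG.1) ?_
  · convert h1 using 2; ring
  intro r hr he
  have hr' := h r hr
  have hconj : ∀ x : ℝ, conj (Complex.exp (x * Complex.I)) = Complex.exp (-(x * Complex.I)) := by
    intro x; rw [← Complex.exp_conj]; simp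
  have hconj' : ∀ x : ℝ, conj (Complex.exp (-(x * Complex.I))) = Complex.exp (x * Complex.I) := by
    intro x; rw [← Complex.exp_conj]; simp
  have hs : s ∈ Set.Icc s t := ⟨le_rfl, hst⟩
  rw [hF.2 r hr, hG.2 r hr, hF.2 s hs, hG.2 s hs] at hr'
  have : (↑‖F r‖ * Complex.exp (↑(θ r) * Complex.I) *
      conj (↑‖G r‖ * Complex.exp (↑(η r) * Complex.I)) *
      conj (↑‖F s‖ * Complex.exp (↑(θ s) * Complex.I) *
        conj (↑‖G s‖ * Complex.exp (↑(η s) * Complex.I)))) =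
      ((-(‖F r‖ * ‖G r‖ * ‖F s‖ * ‖G s‖) : ℝ) : ℂ) := by
    simp only [map_mul, Complex.conj_ofReal, hconj, hconj']
    have e1 : Complex.exp (↑(θ r) * Complex.I) * Complex.exp (-(↑(η r) * Complex.I)) =
        - (Complex.exp (↑(θ s) * Complex.I) * Complex.exp (-(↑(η s) * Complex.I))) := by
      rw [← Complex.exp_add, ← Complex.exp_add]
      have e2 : (θ r * Complex.I + -(η r * Complex.I) : ℂ) = ((θ r - η r : ℝ) : ℂ) * Complex.I := by
        push_cast; ring
      rw [e2, he]
      push_cast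
      rw [add_mul, Complex.exp_add, Complex.exp_pi_mul_I]
      ring_nf
    have e3 : Complex.exp (↑(θ s) * Complex.I) * Complex.exp (-(↑(θ s) * Complex.I)) = 1 := by
      rw [← Complex.exp_add]; simp
    have e4 : Complex.exp (↑(η s) * Complex.I) * Complex.exp (-(↑(η s) * Complex.I)) = 1 := by
      rw [← Complex.exp_add]; simp
    push_cast
    linear_combination (‖F r‖ * ‖G r‖ * ‖F s‖ * ‖G s‖ : ℂ) * (Complex.exp (-(↑(θ s) * Complex.I)) *
      Complex.exp (↑(η s) * Complex.I) * e1 - Complex.exp (↑(η s) * Complex.I) *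
      Complex.exp (-(↑(η s) * Complex.I)) * e3 - e4)
  rw [this, Complex.ofReal_re] at hr'
  have : 0 ≤ ‖F r‖ * ‖G r‖ * ‖F s‖ * ‖G s‖ := by positivity
  linarith

/-- This compares two determinations after a positive rescaling. The two increments actually agree,
but the crude bound is enough throughout. -/
theorem IsAngleOn.abs_sub_lt_of_eq_mul {F G : ℝ → ℂ} {s t : ℝ} {θ η : ℝ → ℝ} (hst : s ≤ t)
    (hF : IsAngleOn F s t θ) (hG : IsAngleOn G s t η) (h0 : ∀ r ∈ Set.Icc s t, F r ≠ 0)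
    (h : ∀ r ∈ Set.Icc s t, ∃ k : ℝ, 0 < k ∧ G r = k * F r) :
    |(θ t - θ s) - (η t - η s)| < 2 * Real.pi := by
  refine hF.abs_sub_lt_of_re hst hG fun r hr => ?_
  have hs : s ∈ Set.Icc s t := ⟨le_rfl, hst⟩
  obtain ⟨k, hk, hk'⟩ := h r hr
  obtain ⟨l, hl, hl'⟩ := h s hs
  have : F r * conj (G r) * conj (F s * conj (G s)) =
      ((k * l * Complex.normSq (F r) * Complex.normSq (F s) : ℝ) : ℂ) := by
    rw [hk', hl']
    push_cast
    rw [Complex.normSq_eq_conj_mul_self, Complex.normSq_eq_conj_mul_self]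
    simp only [map_mul, Complex.conj_ofReal, Complex.conj_conj]
    ring
  rw [this, Complex.ofReal_re]
  have := Complex.normSq_pos.2 (h0 r hr)
  have := Complex.normSq_pos.2 (h0 s hs)
  positivity

/-- A closed half-plane misses the direction `-w` of its inner normal's opposite. -/
theorem IsAngleOn.abs_sub_lt_of_re_nonneg {F : ℝ → ℂ} {s t : ℝ} {θ : ℝ → ℝ} {w : ℂ} (hw : w ≠ 0)
    (hst : s ≤ t) (hF : IsAngleOn F s t θ) (h0 : ∀ r ∈ Set.Icc s t, F r ≠ 0)
    (h : ∀ r ∈ Set.Icc s t, 0 ≤ (conj w * F r).re) : |θ t - θ s| < 2 * Real.pi := by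
  refine abs_sub_lt_two_pi_of_avoid (φ := (-w).arg) hst hF.1 fun r hr he => ?_
  have h1 := h r hr
  rw [hF.2 r hr, he] at h1
  have h2 := Complex.norm_mul_exp_arg_mul_I (-w)
  have hn : (‖-w‖ : ℂ) ≠ 0 := by simpa using hw
  have h3 : conj w * (↑‖F r‖ * Complex.exp (↑(-w).arg * Complex.I)) =
      ((-(‖F r‖ * ‖w‖) : ℝ) : ℂ) := by
    apply mul_left_cancel₀ hn
    have h4 : (‖w‖ : ℂ) ^ 2 = conj w * w := by
      rw [← Complex.ofReal_pow, ← Complex.normSq_eq_norm_sq, Complex.normSq_eq_conj_mul_self]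
    rw [norm_neg] at h2 ⊢
    push_cast
    linear_combination conj w * ‖F r‖ * h2 + ‖F r‖ * h4
  rw [h3, Complex.ofReal_re] at h1
  have := norm_pos_iff.2 (h0 r hr)
  have := norm_pos_iff.2 hw
  nlinarith [mul_pos (norm_pos_iff.2 (h0 r hr)) (norm_pos_iff.2 hw)]

theorem IsAngleOn.abs_sub_lt_of_monotoneOn {F : ℝ → ℂ} {s t : ℝ} {θ : ℝ → ℝ} {w : ℂ} (hw : w ≠ 0)
    (hst : s ≤ t) (hFc : ContinuousOn F (Set.Icc s t)) (hF : IsAngleOn F s t θ)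
    (h0 : ∀ r ∈ Set.Icc s t, F r ≠ 0)
    (h : MonotoneOn (fun r => (conj w * F r).re) (Set.Icc s t)) :
    |θ t - θ s| < 4 * Real.pi := by
  have hpi := Real.pi_pos
  have hs : s ∈ Set.Icc s t := ⟨le_rfl, hst⟩
  have ht : t ∈ Set.Icc s t := ⟨hst, le_rfl⟩
  have neg : ∀ t' ∈ Set.Icc s t, (conj w * F t').re ≤ 0 → |θ t' - θ s| < 2 * Real.pi := by
    intro t' ht' h1
    refine (hF.mono le_rfl ht'.2).abs_sub_lt_of_re_nonneg (neg_ne_zero.2 hw) ht'.1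
      (fun r hr => h0 r ⟨hr.1, hr.2.trans ht'.2⟩) fun r hr => ?_
    have := h ⟨hr.1, hr.2.trans ht'.2⟩ ht' hr.2
    simp only [map_neg, neg_mul, Complex.neg_re] at this ⊢
    linarith
  have pos : ∀ s' ∈ Set.Icc s t, 0 ≤ (conj w * F s').re → |θ t - θ s'| < 2 * Real.pi := by
    intro s' hs' h1
    exact (hF.mono hs'.1 le_rfl).abs_sub_lt_of_re_nonneg hw hs'.2
      (fun r hr => h0 r ⟨hs'.1.trans hr.1, hr.2⟩)
      fun r hr => h1.trans (h hs' ⟨hs'.1.trans hr.1, hr.2⟩ hr.1)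
  rcases le_total 0 (conj w * F s).re with h1 | h1
  · have := pos s hs h1
    linarith
  rcases le_total (conj w * F t).re 0 with h2 | h2
  · have := neg t ht h2
    linarith
  -- A zero `m` of the monotone projection splits the curve into two pieces, each in a closed
  -- half-plane and each turning by less than `2π`.
  have hc : ContinuousOn (fun r => (conj w * F r).re) (Set.Icc s t) := by fun_prop
  obtain ⟨m, hm, hm0⟩ := intermediate_value_Icc hst hc ⟨h1, h2⟩
  have a1 := neg m hm hm0.le
  have a2 := pos m hm hm0.ge
  have := abs_sub_le (θ t) (θ m) (θ s)
  linarith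

end PlaneAngle

namespace Spread

/-! ### The sphere as a projective line, and the angular coordinate about two points -/

noncomputable section Spinors

open ComplexConjugate

theorem sq_add_sq_add_sq_S2 (z : S2) :
    (z : E3) 0 ^ 2 + (z : E3) 1 ^ 2 + (z : E3) 2 ^ 2 = 1 := by
  have h := EuclideanSpace.norm_sq_eq (z : E3)
  rw [norm_S2, Fin.sum_univ_three] at h
  simp only [Real.norm_eq_abs, sq_abs] at h
  linarith

/-- The four products are the entries of the rank-one projection `(1 + z·σ)/2`, with `σ` the Pauli
matrices. The vector is determined only up to phase and cannot be chosen continuously, so continuity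
is always read off from such products. -/
theorem exists_spinor (z : S2) : ∃ u : ℂ × ℂ,
    u.1 * conj u.1 = (1 + (z : E3) 2) / 2 ∧
    u.1 * conj u.2 = ((z : E3) 0 - (z : E3) 1 * Complex.I) / 2 ∧
    u.2 * conj u.1 = ((z : E3) 0 + (z : E3) 1 * Complex.I) / 2 ∧
    u.2 * conj u.2 = (1 - (z : E3) 2) / 2 := by
  have h := sq_add_sq_add_sq_S2 z
  generalize (z : E3) 0 = a at *
  generalize (z : E3) 1 = b at *
  generalize (z : E3) 2 = c at *
  have hI := Complex.I_sq
  -- At the south pole the first component vanishes, and the formula that divides by it fails.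
  rcases eq_or_ne c (-1) with rfl | hc
  · have ha : a = 0 := by nlinarith
    have hb : b = 0 := by nlinarith
    refine ⟨(0, 1), ?_, ?_, ?_, ?_⟩ <;> simp [ha, hb]
  have hc' : 0 < (1 + c) / 2 := by
    rcases lt_trichotomy c (-1) with h1 | h1 | h1
    · nlinarith
    · exact absurd h1 hc
    · linarith
  obtain ⟨r, hr, hr2⟩ : ∃ r : ℝ, 0 < r ∧ r ^ 2 = (1 + c) / 2 :=
    ⟨_, Real.sqrt_pos.2 hc', Real.sq_sqrt hc'.le⟩
  have hrC : (r : ℂ) ≠ 0 := by exact_mod_cast hr.ne'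
  have hrC2 : (r : ℂ) ^ 2 = (1 + c) / 2 := by exact_mod_cast hr2
  have hC : (a : ℂ) ^ 2 + b ^ 2 + c ^ 2 = 1 := by
    rw [← Complex.ofReal_one, ← h]; push_cast; rfl
  refine ⟨(r, (a + b * Complex.I) / (2 * r)), ?_, ?_, ?_, ?_⟩
  · simp only [Complex.conj_ofReal]
    linear_combination hrC2
  · simp only [map_div₀, map_add, map_mul, Complex.conj_ofReal, Complex.conj_I, Complex.conj_ofNat]
    field_simp
    ring
  · simp only [Complex.conj_ofReal]
    field_simp
  · simp only [map_div₀, map_add, map_mul, Complex.conj_ofReal, Complex.conj_I, Complex.conj_ofNat]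
    field_simp
    linear_combination hC - b ^ 2 * hI - (1 - c) * 2 * hrC2

/-- A unit vector of `ℂ²` spanning the line that corresponds to `z` under the identification of the
sphere with the complex projective line. -/
def spinor (z : S2) : ℂ × ℂ := (exists_spinor z).choose

theorem spinor_one_one (z : S2) :
    (spinor z).1 * conj (spinor z).1 = (1 + (z : E3) 2) / 2 := (exists_spinor z).choose_spec.1

theorem spinor_one_two (z : S2) :
    (spinor z).1 * conj (spinor z).2 = ((z : E3) 0 - (z : E3) 1 * Complex.I) / 2 :=
  (exists_spinor z).choose_spec.2.1

theorem spinor_two_one (z : S2) :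
    (spinor z).2 * conj (spinor z).1 = ((z : E3) 0 + (z : E3) 1 * Complex.I) / 2 :=
  (exists_spinor z).choose_spec.2.2.1

theorem spinor_two_two (z : S2) :
    (spinor z).2 * conj (spinor z).2 = (1 - (z : E3) 2) / 2 := (exists_spinor z).choose_spec.2.2.2

/-- The determinant of the spinors of two points. -/
def bracket (x z : S2) : ℂ := (spinor x).1 * (spinor z).2 - (spinor x).2 * (spinor z).1

/-- The hermitian product of the spinors of two points. -/
def overlap (x z : S2) : ℂ := conj (spinor z).1 * (spinor x).1 + conj (spinor z).2 * (spinor x).2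

/-- The argument of `angular x y z`, as a function of `z`, is an angular coordinate on the sphere
minus the points `x` and `y`. -/
def angular (x y z : S2) : ℂ := bracket x z * conj (bracket y z)

theorem norm_sub_sq_coord (x z : E3) :
    ‖x - z‖ ^ 2 = (x 0 - z 0) ^ 2 + (x 1 - z 1) ^ 2 + (x 2 - z 2) ^ 2 := by
  rw [EuclideanSpace.norm_sq_eq, Fin.sum_univ_three]
  simp only [Real.norm_eq_abs, sq_abs, PiLp.sub_apply]

/-- For unit spinors the squared modulus of the determinant is `(1 - ⟪x, z⟫) / 2`, a quarter of the
squared chord. -/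
theorem bracket_mul_conj (x z : S2) :
    bracket x z * conj (bracket x z) = ((‖(x : E3) - z‖ ^ 2 / 4 : ℝ) : ℂ) := by
  have hx : ((x : E3) 0 : ℂ) ^ 2 + ((x : E3) 1 : ℂ) ^ 2 + ((x : E3) 2 : ℂ) ^ 2 = 1 := by
    rw [← Complex.ofReal_one, ← sq_add_sq_add_sq_S2 x]; push_cast; rfl
  have hz : ((z : E3) 0 : ℂ) ^ 2 + ((z : E3) 1 : ℂ) ^ 2 + ((z : E3) 2 : ℂ) ^ 2 = 1 := by
    rw [← Complex.ofReal_one, ← sq_add_sq_add_sq_S2 z]; push_cast; rfl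
  have e : bracket x z * conj (bracket x z) =
      ((spinor x).1 * conj (spinor x).1) * ((spinor z).2 * conj (spinor z).2) -
      ((spinor x).1 * conj (spinor x).2) * ((spinor z).2 * conj (spinor z).1) -
      ((spinor x).2 * conj (spinor x).1) * ((spinor z).1 * conj (spinor z).2) +
      ((spinor x).2 * conj (spinor x).2) * ((spinor z).1 * conj (spinor z).1) := by
    simp only [bracket, map_sub, map_mul]
    ring
  rw [e, norm_sub_sq_coord]
  simp only [spinor_one_one, spinor_one_two, spinor_two_one, spinor_two_two]
  push_cast
  linear_combination (-1 / 4 : ℂ) * hx - 1 / 4 * hz +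
    (x : E3) 1 * (z : E3) 1 / 2 * Complex.I_sq

theorem bracket_ne_zero {x z : S2} (h : x ≠ z) : bracket x z ≠ 0 := by
  intro h0
  have h1 := bracket_mul_conj x z
  rw [h0, zero_mul, eq_comm, Complex.ofReal_eq_zero] at h1
  have : 0 < ‖(x : E3) - z‖ := norm_pos_iff.2 (sub_ne_zero.2 fun h2 => h (Subtype.ext h2))
  have : 0 < ‖(x : E3) - z‖ ^ 2 / 4 := by positivity
  linarith

theorem angular_ne_zero {x y z : S2} (hx : x ≠ z) (hy : y ≠ z) : angular x y z ≠ 0 :=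
  mul_ne_zero (bracket_ne_zero hx) ((map_ne_zero _).2 (bracket_ne_zero hy))

/-- The linear part of the affine function `angular x y`. -/
def angularLin (x y : S2) (w : E3) : ℂ :=
  ((spinor x).2 * conj (spinor y).2 * w 2 - (spinor x).1 * conj (spinor y).1 * w 2 -
    (spinor x).1 * conj (spinor y).2 * (w 0 + w 1 * Complex.I) -
    (spinor x).2 * conj (spinor y).1 * (w 0 - w 1 * Complex.I)) / 2

theorem continuous_angularLin (x y : S2) : Continuous (angularLin x y) := by
  unfold angularLin
  fun_prop

theorem angularLin_add (x y : S2) (v w : E3) :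
    angularLin x y (v + w) = angularLin x y v + angularLin x y w := by
  simp only [angularLin, PiLp.add_apply]
  push_cast
  ring

theorem angularLin_smul (x y : S2) (c : ℝ) (w : E3) :
    angularLin x y (c • w) = c * angularLin x y w := by
  simp only [angularLin, PiLp.smul_apply, smul_eq_mul]
  push_cast
  ring

/-- The spinor of `z` enters only through its products with its own conjugate, and these are affine
in the coordinates of `z`. -/
theorem angular_eq (x y z : S2) : angular x y z = ((spinor x).1 * conj (spinor y).1 +
    (spinor x).2 * conj (spinor y).2) / 2 + angularLin x y z := by
  have e : angular x y z =
      (spinor x).1 * conj (spinor y).1 * ((spinor z).2 * conj (spinor z).2) -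
      (spinor x).1 * conj (spinor y).2 * ((spinor z).2 * conj (spinor z).1) -
      (spinor x).2 * conj (spinor y).1 * ((spinor z).1 * conj (spinor z).2) +
      (spinor x).2 * conj (spinor y).2 * ((spinor z).1 * conj (spinor z).1) := by
    simp only [angular, bracket, map_sub, map_mul]
    ring
  rw [e, angularLin]
  simp only [spinor_one_one, spinor_one_two, spinor_two_one, spinor_two_two]
  ring

theorem bracket_self (x : S2) : bracket x x = 0 := by
  unfold bracket; ring

theorem angular_left (x y : S2) : angular x y x = 0 := by
  rw [angular, bracket_self, zero_mul]

theorem angular_right (x y : S2) : angular x y y = 0 := by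
  rw [angular, bracket_self, map_zero, mul_zero]

theorem continuous_angular (x y : S2) : Continuous (angular x y) := by
  have : angular x y = fun z : S2 => ((spinor x).1 * conj (spinor y).1 +
    (spinor x).2 * conj (spinor y).2) / 2 + angularLin x y z := funext (angular_eq x y)
  rw [this]
  exact continuous_const.add ((continuous_angularLin x y).comp continuous_subtype_val)

/-- The affine function `angular x y` vanishes at `x`, so on differences from `x` only its linear
part remains. -/
theorem angularLin_sub_left (x y z : S2) : angularLin x y ((z : E3) - x) = angular x y z := by
  have h1 := angular_eq x y z
  have h2 := angular_eq x y x
  rw [angular_left] at h2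
  have h3 := angularLin_add x y ((z : E3) - x) x
  rw [sub_add_cancel] at h3
  linear_combination -h1 + h2 - h3

theorem angularLin_sub_right (x y z : S2) : angularLin x y ((z : E3) - y) = angular x y z := by
  have h1 := angular_eq x y z
  have h2 := angular_eq x y y
  rw [angular_right] at h2
  have h3 := angularLin_add x y ((z : E3) - y) y
  rw [sub_add_cancel] at h3
  linear_combination -h1 + h2 - h3

/-- This serves to show that the linear part does not vanish on unit tangent vectors at `x` or at
`y`. -/
theorem normSq_angularLin (x y : S2) (w : E3) : Complex.normSq (angularLin x y w) =
    ((w 0 ^ 2 + w 1 ^ 2 + w 2 ^ 2) * (1 - ((x : E3) 0 * (y : E3) 0 + (x : E3) 1 * (y : E3) 1 +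
      (x : E3) 2 * (y : E3) 2)) + 2 * (w 0 * (x : E3) 0 + w 1 * (x : E3) 1 + w 2 * (x : E3) 2) *
      (w 0 * (y : E3) 0 + w 1 * (y : E3) 1 + w 2 * (y : E3) 2)) / 8 := by
  apply Complex.ofReal_injective
  -- Grouping by the projection entries of `x` eliminates its spinor; `e1` to `e4` then do the same
  -- for `y`.
  have e : (Complex.normSq (angularLin x y w) : ℂ) =
      ((spinor x).2 * conj (spinor x).2 * (
        (w 2 * (spinor y).2 - (w 0 + w 1 * Complex.I) * (spinor y).1) *
        (w 2 * conj (spinor y).2 - (w 0 - w 1 * Complex.I) * conj (spinor y).1)) +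
      (spinor x).1 * conj (spinor x).1 * (
        (w 2 * (spinor y).1 + (w 0 - w 1 * Complex.I) * (spinor y).2) *
        (w 2 * conj (spinor y).1 + (w 0 + w 1 * Complex.I) * conj (spinor y).2)) -
      (spinor x).2 * conj (spinor x).1 * (
        (w 2 * conj (spinor y).2 - (w 0 - w 1 * Complex.I) * conj (spinor y).1) *
        (w 2 * (spinor y).1 + (w 0 - w 1 * Complex.I) * (spinor y).2)) -
      (spinor x).1 * conj (spinor x).2 * (
        (w 2 * conj (spinor y).1 + (w 0 + w 1 * Complex.I) * conj (spinor y).2) *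
        (w 2 * (spinor y).2 - (w 0 + w 1 * Complex.I) * (spinor y).1))) / 4 := by
    rw [Complex.normSq_eq_conj_mul_self, angularLin]
    simp only [map_div₀, map_sub, map_add, map_mul, Complex.conj_ofReal, Complex.conj_I,
      Complex.conj_ofNat, Complex.conj_conj]
    ring
  have h11 := spinor_one_one y
  have h12 := spinor_one_two y
  have h21 := spinor_two_one y
  have h22 := spinor_two_two y
  rw [e]
  simp only [spinor_one_one, spinor_one_two, spinor_two_one, spinor_two_two]
  have e1 : (w 2 * (spinor y).2 - (w 0 + w 1 * Complex.I) * (spinor y).1) *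
        (w 2 * conj (spinor y).2 - (w 0 - w 1 * Complex.I) * conj (spinor y).1) =
      w 2 ^ 2 * ((1 - (y : E3) 2) / 2) - w 2 * (w 0 - w 1 * Complex.I) *
      (((y : E3) 0 + (y : E3) 1 * Complex.I) / 2) - w 2 * (w 0 + w 1 * Complex.I) *
      (((y : E3) 0 - (y : E3) 1 * Complex.I) / 2) + (w 0 ^ 2 + w 1 ^ 2) *
      ((1 + (y : E3) 2) / 2) := by
    rw [← h11, ← h12, ← h21, ← h22]
    linear_combination -w 1 ^ 2 * (spinor y).1 * conj (spinor y).1 * Complex.I_sq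
  have e2 : (w 2 * (spinor y).1 + (w 0 - w 1 * Complex.I) * (spinor y).2) *
        (w 2 * conj (spinor y).1 + (w 0 + w 1 * Complex.I) * conj (spinor y).2) =
      w 2 ^ 2 * ((1 + (y : E3) 2) / 2) + w 2 * (w 0 - w 1 * Complex.I) *
      (((y : E3) 0 + (y : E3) 1 * Complex.I) / 2) + w 2 * (w 0 + w 1 * Complex.I) *
      (((y : E3) 0 - (y : E3) 1 * Complex.I) / 2) + (w 0 ^ 2 + w 1 ^ 2) *
      ((1 - (y : E3) 2) / 2) := by
    rw [← h11, ← h12, ← h21, ← h22]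
    linear_combination -w 1 ^ 2 * (spinor y).2 * conj (spinor y).2 * Complex.I_sq
  have e3 : (w 2 * conj (spinor y).2 - (w 0 - w 1 * Complex.I) * conj (spinor y).1) *
        (w 2 * (spinor y).1 + (w 0 - w 1 * Complex.I) * (spinor y).2) =
      w 2 ^ 2 * (((y : E3) 0 - (y : E3) 1 * Complex.I) / 2) +
      w 2 * (w 0 - w 1 * Complex.I) * ((1 - (y : E3) 2) / 2) -
      w 2 * (w 0 - w 1 * Complex.I) * ((1 + (y : E3) 2) / 2) -
      (w 0 - w 1 * Complex.I) ^ 2 * (((y : E3) 0 + (y : E3) 1 * Complex.I) / 2) := by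
    rw [← h11, ← h12, ← h21, ← h22]
    ring
  have e4 : (w 2 * conj (spinor y).1 + (w 0 + w 1 * Complex.I) * conj (spinor y).2) *
        (w 2 * (spinor y).2 - (w 0 + w 1 * Complex.I) * (spinor y).1) =
      w 2 ^ 2 * (((y : E3) 0 + (y : E3) 1 * Complex.I) / 2) +
      w 2 * (w 0 + w 1 * Complex.I) * ((1 - (y : E3) 2) / 2) -
      w 2 * (w 0 + w 1 * Complex.I) * ((1 + (y : E3) 2) / 2) -
      (w 0 + w 1 * Complex.I) ^ 2 * (((y : E3) 0 - (y : E3) 1 * Complex.I) / 2) := by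
    rw [← h11, ← h12, ← h21, ← h22]
    ring
  rw [e1, e2, e3, e4]
  push_cast
  have hI := Complex.I_sq
  generalize Complex.I = J at hI
  have hI' : J ^ 2 = -1 := hI
  ring_nf
  have hI4 : J ^ 4 = 1 := by linear_combination (J ^ 2 - 1) * hI
  simp only [hI, hI4]
  ring

end Spinors

/-! ### Angles under maps close to the identity -/

noncomputable section Distortion

open ComplexConjugate

/-- The ratio of the brackets of two nearby pairs of points, with the ambiguity of the spinors removed
and normalized so that it is close to `‖x - p‖² / 4`. -/
def bracketRatio (x p x' p' : S2) : ℂ :=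
  conj (bracket x p) * bracket x' p' * (overlap x x' * overlap p p')

/-- Each spinor occurs together with its conjugate, so the phases cancel and a polynomial in
coordinates results. With `d = x - p` and `d' = x' - p'` it is `(1 + x·x')(d·d') - (d × d')·(x' ×
x)`, with imaginary part `(d × d')·(x' + x)`. -/
theorem bracketRatio_eq (x p x' p' : S2) : 8 * bracketRatio x p x' p' =
    (((1 + ((x : E3) 0 * (x' : E3) 0 + (x : E3) 1 * (x' : E3) 1 + (x : E3) 2 * (x' : E3) 2)) *
      (((x : E3) 0 - (p : E3) 0) * ((x' : E3) 0 - (p' : E3) 0) +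
        ((x : E3) 1 - (p : E3) 1) * ((x' : E3) 1 - (p' : E3) 1) +
        ((x : E3) 2 - (p : E3) 2) * ((x' : E3) 2 - (p' : E3) 2)) -
      ((((x : E3) 1 - (p : E3) 1) * ((x' : E3) 2 - (p' : E3) 2) -
          ((x : E3) 2 - (p : E3) 2) * ((x' : E3) 1 - (p' : E3) 1)) *
          ((x' : E3) 1 * (x : E3) 2 - (x' : E3) 2 * (x : E3) 1) +
        (((x : E3) 2 - (p : E3) 2) * ((x' : E3) 0 - (p' : E3) 0) -
          ((x : E3) 0 - (p : E3) 0) * ((x' : E3) 2 - (p' : E3) 2)) *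
          ((x' : E3) 2 * (x : E3) 0 - (x' : E3) 0 * (x : E3) 2) +
        (((x : E3) 0 - (p : E3) 0) * ((x' : E3) 1 - (p' : E3) 1) -
          ((x : E3) 1 - (p : E3) 1) * ((x' : E3) 0 - (p' : E3) 0)) *
          ((x' : E3) 0 * (x : E3) 1 - (x' : E3) 1 * (x : E3) 0)) : ℝ) : ℂ) +
    (((((x : E3) 1 - (p : E3) 1) * ((x' : E3) 2 - (p' : E3) 2) -
          ((x : E3) 2 - (p : E3) 2) * ((x' : E3) 1 - (p' : E3) 1)) *
          ((x' : E3) 0 + (x : E3) 0) +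
        (((x : E3) 2 - (p : E3) 2) * ((x' : E3) 0 - (p' : E3) 0) -
          ((x : E3) 0 - (p : E3) 0) * ((x' : E3) 2 - (p' : E3) 2)) *
          ((x' : E3) 1 + (x : E3) 1) +
        (((x : E3) 0 - (p : E3) 0) * ((x' : E3) 1 - (p' : E3) 1) -
          ((x : E3) 1 - (p : E3) 1) * ((x' : E3) 0 - (p' : E3) 0)) *
          ((x' : E3) 2 + (x : E3) 2) : ℝ) : ℂ) * Complex.I := by
  have hx : ((x : E3) 0 : ℂ) ^ 2 + ((x : E3) 1 : ℂ) ^ 2 + ((x : E3) 2 : ℂ) ^ 2 = 1 := by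
    rw [← Complex.ofReal_one, ← sq_add_sq_add_sq_S2 x]; push_cast; rfl
  have hx' : ((x' : E3) 0 : ℂ) ^ 2 + ((x' : E3) 1 : ℂ) ^ 2 + ((x' : E3) 2 : ℂ) ^ 2 = 1 := by
    rw [← Complex.ofReal_one, ← sq_add_sq_add_sq_S2 x']; push_cast; rfl
  have e : bracketRatio x p x' p' =
      (((spinor x').1 * conj (spinor x').1) * ((spinor x).1 * conj (spinor x).1) +
        ((spinor x').1 * conj (spinor x').2) * ((spinor x).2 * conj (spinor x).1)) *
      (((spinor p').2 * conj (spinor p').1) * ((spinor p).1 * conj (spinor p).2) +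
        ((spinor p').2 * conj (spinor p').2) * ((spinor p).2 * conj (spinor p).2)) -
      (((spinor x').1 * conj (spinor x').1) * ((spinor x).1 * conj (spinor x).2) +
        ((spinor x').1 * conj (spinor x').2) * ((spinor x).2 * conj (spinor x).2)) *
      (((spinor p').2 * conj (spinor p').1) * ((spinor p).1 * conj (spinor p).1) +
        ((spinor p').2 * conj (spinor p').2) * ((spinor p).2 * conj (spinor p).1)) -
      (((spinor x').2 * conj (spinor x').1) * ((spinor x).1 * conj (spinor x).1) +
        ((spinor x').2 * conj (spinor x').2) * ((spinor x).2 * conj (spinor x).1)) *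
      (((spinor p').1 * conj (spinor p').1) * ((spinor p).1 * conj (spinor p).2) +
        ((spinor p').1 * conj (spinor p').2) * ((spinor p).2 * conj (spinor p).2)) +
      (((spinor x').2 * conj (spinor x').1) * ((spinor x).1 * conj (spinor x).2) +
        ((spinor x').2 * conj (spinor x').2) * ((spinor x).2 * conj (spinor x).2)) *
      (((spinor p').1 * conj (spinor p').1) * ((spinor p).1 * conj (spinor p).1) +
        ((spinor p').1 * conj (spinor p').2) * ((spinor p).2 * conj (spinor p).1)) := by
    simp only [bracketRatio, bracket, overlap, map_sub, map_mul]
    ring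
  rw [e]
  simp only [spinor_one_one, spinor_one_two, spinor_two_one, spinor_two_two]
  push_cast
  generalize ((x : E3) 0 : ℂ) = x0 at *
  generalize ((x : E3) 1 : ℂ) = x1 at *
  generalize ((x : E3) 2 : ℂ) = x2 at *
  generalize ((x' : E3) 0 : ℂ) = y0 at *
  generalize ((x' : E3) 1 : ℂ) = y1 at *
  generalize ((x' : E3) 2 : ℂ) = y2 at *
  generalize ((p : E3) 0 : ℂ) = p0 at *
  generalize ((p : E3) 1 : ℂ) = p1 at *
  generalize ((p : E3) 2 : ℂ) = p2 at *
  generalize ((p' : E3) 0 : ℂ) = q0 at *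
  generalize ((p' : E3) 1 : ℂ) = q1 at *
  generalize ((p' : E3) 2 : ℂ) = q2 at *
  have hI := Complex.I_sq
  generalize Complex.I = J at *
  have hI4 : J ^ 4 = 1 := by linear_combination (J ^ 2 - 1) * hI
  -- Only the unit length of `x` and `x'` is needed; the powers of the imaginary unit are reduced
  -- afterwards.
  linear_combination (norm := skip) -(1 - (x0 * p0 + x1 * p1 + x2 * p2)) * hx' -
    (1 - (y0 * q0 + y1 * q1 + y2 * q2) + (y0 ^ 2 + y1 ^ 2 + y2 ^ 2 - 1)) * hx
  ring_nf
  simp only [hI, hI4]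
  ring

/-- Hadamard's inequality: Cauchy–Schwarz for `(a × b)·c`, then Lagrange's identity for `a × b`. -/
theorem sq_det_le (a b c : Fin 3 → ℝ) :
    ((a 1 * b 2 - a 2 * b 1) * c 0 + (a 2 * b 0 - a 0 * b 2) * c 1 +
      (a 0 * b 1 - a 1 * b 0) * c 2) ^ 2 ≤
    (a 0 ^ 2 + a 1 ^ 2 + a 2 ^ 2) * (b 0 ^ 2 + b 1 ^ 2 + b 2 ^ 2) *
      (c 0 ^ 2 + c 1 ^ 2 + c 2 ^ 2) := by
  have h1 : ((a 1 * b 2 - a 2 * b 1) * c 0 + (a 2 * b 0 - a 0 * b 2) * c 1 +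
      (a 0 * b 1 - a 1 * b 0) * c 2) ^ 2 ≤ ((a 1 * b 2 - a 2 * b 1) ^ 2 +
      (a 2 * b 0 - a 0 * b 2) ^ 2 + (a 0 * b 1 - a 1 * b 0) ^ 2) *
      (c 0 ^ 2 + c 1 ^ 2 + c 2 ^ 2) := by
    generalize a 1 * b 2 - a 2 * b 1 = u
    generalize a 2 * b 0 - a 0 * b 2 = v
    generalize a 0 * b 1 - a 1 * b 0 = w
    nlinarith [sq_nonneg (u * c 1 - v * c 0), sq_nonneg (u * c 2 - w * c 0),
      sq_nonneg (v * c 2 - w * c 1)]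
  refine h1.trans (mul_le_mul_of_nonneg_right ?_ (by positivity))
  nlinarith [sq_nonneg (a 0 * b 0 + a 1 * b 1 + a 2 * b 2)]

theorem norm_sq_coord (x : E3) : ‖x‖ ^ 2 = x 0 ^ 2 + x 1 ^ 2 + x 2 ^ 2 := by
  rw [EuclideanSpace.norm_sq_eq, Fin.sum_univ_three]
  simp only [Real.norm_eq_abs, sq_abs]

theorem abs_det_le (a b c : E3) :
    |(a 1 * b 2 - a 2 * b 1) * c 0 + (a 2 * b 0 - a 0 * b 2) * c 1 +
      (a 0 * b 1 - a 1 * b 0) * c 2| ≤ ‖a‖ * ‖b‖ * ‖c‖ := by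
  apply abs_le_of_sq_le_sq _ (by positivity)
  rw [mul_pow, mul_pow, norm_sq_coord, norm_sq_coord, norm_sq_coord]
  exact sq_det_le a b c

theorem inner_coord (x y : E3) : ⟪x, y⟫_ℝ = x 0 * y 0 + x 1 * y 1 + x 2 * y 2 := by
  rw [PiLp.inner_apply, Fin.sum_univ_three]
  simp only [RCLike.inner_apply, conj_trivial]
  ring

theorem exists_cross (x y : S2) : ∃ u : E3, u 0 = (y : E3) 1 * (x : E3) 2 - (y : E3) 2 * (x : E3) 1 ∧
    u 1 = (y : E3) 2 * (x : E3) 0 - (y : E3) 0 * (x : E3) 2 ∧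
    u 2 = (y : E3) 0 * (x : E3) 1 - (y : E3) 1 * (x : E3) 0 ∧ ‖u‖ ≤ 1 := by
  refine ⟨!₂[(y : E3) 1 * (x : E3) 2 - (y : E3) 2 * (x : E3) 1,
    (y : E3) 2 * (x : E3) 0 - (y : E3) 0 * (x : E3) 2,
    (y : E3) 0 * (x : E3) 1 - (y : E3) 1 * (x : E3) 0], rfl, rfl, rfl, ?_⟩
  apply le_of_sq_le_sq _ zero_le_one
  rw [norm_sq_coord]
  have h1 := sq_add_sq_add_sq_S2 x
  have h2 := sq_add_sq_add_sq_S2 y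
  have h3 : ((y : E3) 0 ^ 2 + (y : E3) 1 ^ 2 + (y : E3) 2 ^ 2) *
    ((x : E3) 0 ^ 2 + (x : E3) 1 ^ 2 + (x : E3) 2 ^ 2) = 1 := by rw [h1, h2, one_mul]
  change ((y : E3) 1 * (x : E3) 2 - (y : E3) 2 * (x : E3) 1) ^ 2 +
    ((y : E3) 2 * (x : E3) 0 - (y : E3) 0 * (x : E3) 2) ^ 2 +
    ((y : E3) 0 * (x : E3) 1 - (y : E3) 1 * (x : E3) 0) ^ 2 ≤ 1 ^ 2
  linarith [sq_nonneg ((y : E3) 0 * (x : E3) 0 + (y : E3) 1 * (x : E3) 1 +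
    (y : E3) 2 * (x : E3) 2)]

/-- Here `D = ‖d‖²`, `τ = d·η`, `ρ = ‖x' - x‖²`, and `A`, `B` are the two determinants. The real
part contributes `2 + 1 + 1` and the imaginary part `2`. -/
theorem norm_error_le {ε D τ A B ρ : ℝ} (hε : ε ≤ 1) (hD0 : 0 ≤ D)
    (hτ : |τ| ≤ ε * D) (hA : |A| ≤ 2 * (ε * D)) (hB : |B| ≤ ε * D) (hρ0 : 0 ≤ ρ) (hρ : ρ ≤ ε) :
    ‖((2 * τ - ρ / 2 * (D + τ) - B : ℝ) : ℂ) + (A : ℂ) * Complex.I‖ ≤ 6 * (ε * D) := by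
  have hτD : |D + τ| ≤ 2 * D := by
    rw [abs_le] at hτ ⊢
    constructor <;> nlinarith
  have h1 : |2 * τ - ρ / 2 * (D + τ) - B| ≤ 2 * (ε * D) + ε * D + ε * D := by
    refine (abs_sub _ _).trans (add_le_add ((abs_sub _ _).trans (add_le_add ?_ ?_)) hB)
    · rw [abs_mul, abs_two]; linarith
    · rw [abs_mul, abs_of_nonneg (by positivity)]
      calc ρ / 2 * |D + τ| ≤ ρ / 2 * (2 * D) := mul_le_mul_of_nonneg_left hτD (by positivity)
        _ = ρ * D := by ring
        _ ≤ ε * D := mul_le_mul_of_nonneg_right hρ hD0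
  refine (norm_add_le _ _).trans ?_
  rw [norm_mul, Complex.norm_I, mul_one, Complex.norm_real, Complex.norm_real]
  simp only [Real.norm_eq_abs]
  linarith

/-- Since `d × (d + η) = d × η`, every term left after the subtraction carries a factor `η` or `ρ`.
-/
theorem bracketRatio_eq_of_sub {x p x' p' : S2} {d η v u : E3} {ρ : ℝ}
    (hd : ∀ i, (x : E3) i - (p : E3) i = d i)
    (hη : ∀ i, (x' : E3) i - (p' : E3) i = d i + η i)
    (hv : ∀ i, (x' : E3) i + (x : E3) i = v i)
    (hu0 : u 0 = (x' : E3) 1 * (x : E3) 2 - (x' : E3) 2 * (x : E3) 1)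
    (hu1 : u 1 = (x' : E3) 2 * (x : E3) 0 - (x' : E3) 0 * (x : E3) 2)
    (hu2 : u 2 = (x' : E3) 0 * (x : E3) 1 - (x' : E3) 1 * (x : E3) 0)
    (hρ : (x : E3) 0 * (x' : E3) 0 + (x : E3) 1 * (x' : E3) 1 + (x : E3) 2 * (x' : E3) 2 =
      1 - ρ / 2) :
    8 * (bracketRatio x p x' p' - ((‖d‖ ^ 2 / 4 : ℝ) : ℂ)) =
      ((2 * (d 0 * η 0 + d 1 * η 1 + d 2 * η 2) - ρ / 2 * (‖d‖ ^ 2 +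
        (d 0 * η 0 + d 1 * η 1 + d 2 * η 2)) - ((d 1 * η 2 - d 2 * η 1) * u 0 +
        (d 2 * η 0 - d 0 * η 2) * u 1 + (d 0 * η 1 - d 1 * η 0) * u 2) : ℝ) : ℂ) +
      (((d 1 * η 2 - d 2 * η 1) * v 0 + (d 2 * η 0 - d 0 * η 2) * v 1 +
        (d 0 * η 1 - d 1 * η 0) * v 2 : ℝ) : ℂ) * Complex.I := by
  have key := bracketRatio_eq x p x' p'
  rw [← hu0, ← hu1, ← hu2, hρ] at key
  simp only [hd, hη, hv] at key
  rw [mul_sub, key, norm_sq_coord]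
  push_cast
  ring

/-- The error is relative: it stays proportional to `‖x - p‖²` however close the points are. The
factor `3` comes from `6 / 8 = 3 / 4`. -/
theorem norm_bracketRatio_sub_le {x p x' p' : S2} {ε : ℝ} (hε : ε ≤ 1)
    (hx : ‖(x' : E3) - x‖ ≤ ε)
    (hd : ‖((x' : E3) - p') - ((x : E3) - p)‖ ≤ ε * ‖(x : E3) - p‖) :
    ‖bracketRatio x p x' p' - ((‖(x : E3) - p‖ ^ 2 / 4 : ℝ) : ℂ)‖ ≤
      3 * ε * (‖(x : E3) - p‖ ^ 2 / 4) := by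
  have hε0 : 0 ≤ ε := (norm_nonneg _).trans hx
  obtain ⟨u, hu0, hu1, hu2, hun⟩ := exists_cross x x'
  obtain ⟨d, hdd⟩ : ∃ d : E3, d = (x : E3) - p := ⟨_, rfl⟩
  obtain ⟨η, hη⟩ : ∃ η : E3, η = ((x' : E3) - p') - d := ⟨_, rfl⟩
  obtain ⟨v, hv⟩ : ∃ v : E3, v = (x' : E3) + x := ⟨_, rfl⟩
  rw [← hdd] at hd ⊢
  rw [← hη] at hd
  have hvn : ‖v‖ ≤ 2 := hv ▸ (norm_add_le _ _).trans (by rw [norm_S2, norm_S2]; norm_num)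
  have hxx : ⟪(x : E3), x'⟫_ℝ = 1 - ‖(x' : E3) - x‖ ^ 2 / 2 := by
    have := norm_sub_sq_real (x' : E3) x
    rw [norm_S2, norm_S2, real_inner_comm] at this
    linarith
  rw [inner_coord] at hxx
  have key := bracketRatio_eq_of_sub (x := x) (p := p) (x' := x') (p' := p') (d := d) (η := η) (v := v) (fun i => by rw [hdd]; rfl)
    (fun i => by rw [hη, PiLp.sub_apply, PiLp.sub_apply]; ring) (fun i => by rw [hv]; rfl)
    hu0 hu1 hu2 hxx
  have hdn : ‖d‖ * ‖η‖ ≤ ε * ‖d‖ ^ 2 := by nlinarith [norm_nonneg d]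
  have hdn0 := mul_nonneg (norm_nonneg d) (norm_nonneg η)
  have hτ : |d 0 * η 0 + d 1 * η 1 + d 2 * η 2| ≤ ε * ‖d‖ ^ 2 := by
    rw [← inner_coord]
    exact (abs_real_inner_le_norm _ _).trans hdn
  have hA := (abs_det_le d η v).trans (mul_le_mul hdn hvn (norm_nonneg v) (hdn0.trans hdn))
  have hB := (abs_det_le d η u).trans (mul_le_mul hdn hun (norm_nonneg u) (hdn0.trans hdn))
  rw [mul_one] at hB
  have hw2 : ‖(x' : E3) - x‖ ^ 2 ≤ ε := by nlinarith [norm_nonneg ((x' : E3) - x)]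
  have h2 := norm_error_le hε (sq_nonneg _) hτ (hA.trans_eq (mul_comm _ _)) hB (sq_nonneg _) hw2
  rw [← key, norm_mul, Complex.norm_ofNat] at h2
  linarith

theorem re_mul_pos_of_close {a b c d : ℂ} {k l m n : ℝ} (hk : 0 < k) (hl : 0 < l) (hm : 0 < m)
    (hn : 0 < n) (ha : ‖a - k‖ ≤ k / 10) (hb : ‖b - l‖ ≤ l / 10) (hc : ‖c - m‖ ≤ m / 10)
    (hd : ‖d - n‖ ≤ n / 10) : 0 < (a * conj b * (conj c * d)).re := by
  have conj_close : ∀ {z : ℂ} {r : ℝ}, ‖z - r‖ ≤ r / 10 → ‖conj z - r‖ ≤ r / 10 := by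
    intro z r h
    have e : conj z - r = conj (z - r) := by rw [map_sub, Complex.conj_ofReal]
    rwa [e, Complex.norm_conj]
  have mul_close : ∀ {z w : ℂ} {r s δ : ℝ}, 0 < r → 0 < s → ‖z - r‖ ≤ δ * r → ‖w - s‖ ≤ δ * s →
      ‖z * w - ((r * s : ℝ) : ℂ)‖ ≤ (2 * δ + δ ^ 2) * (r * s) := by
    intro z w r s δ hr hs hz hw
    have e : z * w - ((r * s : ℝ) : ℂ) = (z - r) * (w - s) + (z - r) * s + r * (w - s) := by
      push_cast; ring
    rw [e]
    refine (norm_add₃_le).trans ?_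
    rw [norm_mul, norm_mul, norm_mul, Complex.norm_of_nonneg hr.le, Complex.norm_of_nonneg hs.le]
    have h1 := mul_le_mul hz hw (norm_nonneg _) ((norm_nonneg _).trans hz)
    have h2 := mul_le_mul_of_nonneg_right hz hs.le
    have h3 := mul_le_mul_of_nonneg_left hw hr.le
    linarith
  -- Multiplying pairwise turns the relative error `0.1` into `0.21` and then into `0.4641 < 1`.
  have h1 := mul_close (δ := 1 / 10) hk hl (z := a) (w := conj b) (by linarith)
    (by linarith [conj_close hb])
  have h2 := mul_close (δ := 1 / 10) hm hn (z := conj c) (w := d)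
    (by linarith [conj_close hc]) (by linarith)
  have h3 := mul_close (mul_pos hk hl) (mul_pos hm hn) h1 h2
  have h4 := (Complex.abs_re_le_norm _).trans h3
  rw [Complex.sub_re, Complex.ofReal_re, abs_le] at h4
  have : 0 < k * l * (m * n) := by positivity
  linarith [h4.1]

/-- The map `g` of the sphere is `ε`-close to the identity, and so is its difference quotient. -/
def IsNearIdentity (ε : ℝ) (g : S2 → S2) : Prop :=
  (∀ x, ‖(g x : E3) - x‖ ≤ ε) ∧
    ∀ x p, ‖((g x : E3) - g p) - ((x : E3) - p)‖ ≤ ε * ‖(x : E3) - p‖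

/-- The constant `1 / 30` makes each of the four bracket ratios a positive number up to a relative
error of `1 / 10`. The overlaps in their product combine to squared moduli, which do not affect the
sign of the real part. -/
theorem re_angular_pos {g : S2 → S2} (hg : IsNearIdentity (1 / 30) g) {x y z w : S2}
    (hxz : x ≠ z) (hyz : y ≠ z) (hxw : x ≠ w) (hyw : y ≠ w) :
    0 < (angular (g x) (g y) (g z) * conj (angular x y z) *
      conj (angular (g x) (g y) (g w) * conj (angular x y w))).re := by
  have close : ∀ a b : S2, ‖bracketRatio a b (g a) (g b) - ((‖(a : E3) - b‖ ^ 2 / 4 : ℝ) : ℂ)‖ ≤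
      ‖(a : E3) - b‖ ^ 2 / 4 / 10 := fun a b =>
    (norm_bracketRatio_sub_le (by norm_num) (hg.1 a) (hg.2 a b)).trans_eq (by ring)
  have pos : ∀ {a b : S2}, a ≠ b → 0 < ‖(a : E3) - b‖ ^ 2 / 4 := by
    intro a b h
    have : 0 < ‖(a : E3) - b‖ := norm_pos_iff.2 (sub_ne_zero.2 fun h2 => h (Subtype.ext h2))
    positivity
  have h := re_mul_pos_of_close (pos hxz) (pos hyz) (pos hxw) (pos hyw) (close x z) (close y z)
    (close x w) (close y w)
  have e : bracketRatio x z (g x) (g z) * conj (bracketRatio y z (g y) (g z)) *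
      (conj (bracketRatio x w (g x) (g w)) * bracketRatio y w (g y) (g w)) =
      ((Complex.normSq (overlap x (g x)) * Complex.normSq (overlap y (g y)) *
        Complex.normSq (overlap z (g z)) * Complex.normSq (overlap w (g w)) : ℝ) : ℂ) *
      (angular (g x) (g y) (g z) * conj (angular x y z) *
      conj (angular (g x) (g y) (g w) * conj (angular x y w))) := by
    push_cast
    simp only [Complex.normSq_eq_conj_mul_self, bracketRatio, angular, map_mul, Complex.conj_conj]
    ring
  rw [e, Complex.re_ofReal_mul] at h
  have hn : 0 ≤ Complex.normSq (overlap x (g x)) * Complex.normSq (overlap y (g y)) *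
        Complex.normSq (overlap z (g z)) * Complex.normSq (overlap w (g w)) := by
    have := Complex.normSq_nonneg
    exact mul_nonneg (mul_nonneg (mul_nonneg (this _) (this _)) (this _)) (this _)
  exact pos_of_mul_pos_right h hn

end Distortion

end Spread

/-! ### `C¹`-small diffeomorphisms have difference quotients close to the identity -/

/-- Smoothness is tested in the stereographic charts. The version on a set is needed because radial
projection is smooth only off the origin. -/
theorem ContMDiffOn.codRestrict_sphere {E F H M : Type*} [NormedAddCommGroup E]
    [InnerProductSpace ℝ E] {m : ℕ∞ω} [NormedAddCommGroup F] [NormedSpace ℝ F]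
    [TopologicalSpace H] {I : ModelWithCorners ℝ F H} [TopologicalSpace M] [ChartedSpace H M]
    [IsManifold I m M] {n : ℕ} [Fact (Module.finrank ℝ E = n + 1)] {f : M → E} {s : Set M}
    (hf : ContMDiffOn I 𝓘(ℝ, E) m f s) (hf' : ∀ x, f x ∈ Metric.sphere (0 : E) 1) :
    ContMDiffOn I (𝓡 n) m (Set.codRestrict _ _ hf' : M → Metric.sphere (0 : E) 1) s := by
  rw [contMDiffOn_iff_target]
  refine ⟨Topology.IsInducing.subtypeVal.continuousOn_iff.2 hf.continuousOn, ?_⟩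
  intro v
  let U : _ ≃ₗᵢ[ℝ] _ :=
    (OrthonormalBasis.fromOrthogonalSpanSingleton
        n (ne_zero_of_mem_unit_sphere (-v))).repr
  have h : ContDiffOn ℝ ω _ Set.univ := U.contDiff.contDiffOn
  have H₁ := (h.comp_inter contDiffOn_stereoToFun).contMDiffOn
  convert! (H₁.of_le le_top).comp' hf using 1
  ext x
  have hfxv : f x = -↑v ↔ ⟪f x, -↑v⟫_ℝ = 1 := by
    have hfx : ‖f x‖ = 1 := by simpa using hf' x
    rw [inner_eq_one_iff_of_norm_eq_one hfx]
    exact norm_eq_of_mem_sphere (-v)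
  simp [chartAt, ChartedSpace.chartAt, Subtype.ext_iff, hfxv, real_inner_comm]

namespace Spread

noncomputable section C1Topology

instance : Fact (Module.finrank ℝ E3 = 2 + 1) := ⟨by simp⟩

open Classical in
/-- Radial projection to the sphere, with an arbitrary value at the origin. -/
def radial (X : E3) : E3 := if X = 0 then EuclideanSpace.single 0 1 else ‖X‖⁻¹ • X

theorem radial_mem (X : E3) : radial X ∈ Metric.sphere (0 : E3) 1 := by
  rw [mem_sphere_zero_iff_norm, radial]
  split_ifs with h
  · simp
  · rw [norm_smul, norm_inv, norm_norm, inv_mul_cancel₀ (norm_ne_zero_iff.2 h)]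

/-- Radial projection as a map to the sphere. -/
def toS2 : E3 → S2 := Set.codRestrict radial _ radial_mem

theorem toS2_coe (x : S2) : toS2 x = x := by
  apply Subtype.ext
  have h0 : (x : E3) ≠ 0 := ne_zero_of_mem_unit_sphere x
  simp [toS2, radial, h0]

theorem contMDiffOn_toS2 : ContMDiffOn 𝓘(ℝ, E3) (𝓡 2) 1 toS2 {0}ᶜ := by
  refine ContMDiffOn.codRestrict_sphere (ContDiffOn.contMDiffOn ?_) _
  have h : ContDiffOn ℝ 1 (fun X : E3 => ‖X‖⁻¹ • X) {0}ᶜ := fun X hX =>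
    (((contDiffAt_norm ℝ hX).inv (norm_ne_zero_iff.2 hX)).smul contDiffAt_id).contDiffWithinAt
  exact h.congr fun X hX => if_neg hX

/-- The differential of the inclusion of the sphere into three-space. -/
def ambient (p : TangentBundle (𝓡 2) S2) : E3 :=
  (tangentMap (𝓡 2) 𝓘(ℝ, E3) ((↑) : S2 → E3) p).2

theorem continuous_ambient : Continuous ambient :=
  (contMDiff_snd_tangentBundle_modelSpace (n := 0) E3 𝓘(ℝ, E3)).continuous.comp
    ((contMDiff_coe_sphere (m := 1)).continuous_tangentMap le_rfl)

/-- The tangent vector of the sphere obtained by projecting radially a vector of three-space. -/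
def radialTangent (q : E3 × E3) : TangentBundle (𝓡 2) S2 :=
  tangentMapWithin 𝓘(ℝ, E3) (𝓡 2) toS2 {0}ᶜ ⟨q.1, q.2⟩

theorem continuousOn_radialTangent : ContinuousOn radialTangent {q | q.1 ≠ 0} := by
  have h := contMDiffOn_toS2.continuousOn_tangentMapWithin le_rfl
    (isOpen_compl_singleton.uniqueMDiffOn)
  refine h.comp (f := fun q : E3 × E3 => (⟨q.1, q.2⟩ : TangentBundle 𝓘(ℝ, E3) E3)) ?_ fun q hq => hq
  exact ((tangentBundleModelSpaceHomeomorph 𝓘(ℝ, E3)).symm.continuous).continuousOn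

/-- Extending `g` radially expresses its tangent map by derivatives in a vector space, where the
mean value inequality is available. -/
theorem hasFDerivAt_comp_toS2 (g : Diff1) {X : E3} (hX : X ≠ 0) :
    ∃ A : E3 →L[ℝ] E3, HasFDerivAt (fun Y => (g (toS2 Y) : E3)) A X ∧
      ∀ v, A v = ambient (tangentMapC g (radialTangent (X, v))) := by
  have h1 : MDifferentiableAt 𝓘(ℝ, E3) (𝓡 2) toS2 X :=
    ((contMDiffOn_toS2.mdifferentiableOn one_ne_zero) X hX).mdifferentiableAt
      (isOpen_compl_singleton.mem_nhds hX)
  have h2 : MDifferentiableAt (𝓡 2) (𝓡 2) g (toS2 X) := g.mdifferentiable one_ne_zero _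
  have h3 : MDifferentiableAt (𝓡 2) 𝓘(ℝ, E3) ((↑) : S2 → E3) (g (toS2 X)) :=
    (contMDiff_coe_sphere (m := 1)).mdifferentiable one_ne_zero _
  have h4 := h3.comp X (h2.comp X h1)
  refine ⟨fderiv ℝ (((↑) : S2 → E3) ∘ (g ∘ toS2)) X,
    (mdifferentiableAt_iff_differentiableAt.1 h4).hasFDerivAt, fun v => ?_⟩
  · rw [← mfderiv_eq_fderiv, mfderiv_comp X h3 (h2.comp X h1), mfderiv_comp X h2 h1]
    rw [radialTangent, tangentMapWithin_eq_tangentMap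
      (isOpen_compl_singleton.uniqueMDiffOn _ hX) h1]
    rfl

/-- The compact set of tangent vectors obtained by projecting the vectors of length at most one based
at points of a spherical shell. -/
def shellTangent : Set (TangentBundle (𝓡 2) S2) :=
  radialTangent '' {q | 1 / 2 ≤ ‖q.1‖ ∧ ‖q.1‖ ≤ 1 ∧ ‖q.2‖ ≤ 1}

theorem isCompact_shellTangent : IsCompact shellTangent := by
  refine IsCompact.image_of_continuousOn ?_ (continuousOn_radialTangent.mono ?_)
  · refine ((isCompact_closedBall (0 : E3) 1).prod (isCompact_closedBall (0 : E3) 1)).of_isClosed_subset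
      ?_ ?_
    · exact (isClosed_le continuous_const continuous_fst.norm).inter
        ((isClosed_le continuous_fst.norm continuous_const).inter
          (isClosed_le continuous_snd.norm continuous_const))
    · rintro q ⟨-, h1, h2⟩
      exact ⟨mem_closedBall_zero_iff.2 h1, mem_closedBall_zero_iff.2 h2⟩
  · rintro q ⟨h, -⟩ h0
    rw [h0, norm_zero] at h
    norm_num at h

/-- Compact-open convergence of tangent maps is uniform on the compact set `shellTangent`. -/
theorem eventually_near_on_shell {ε : ℝ} (hε : 0 < ε) : ∀ᶠ g in 𝓝 (1 : Diff1),
    ∀ p ∈ shellTangent, ‖((tangentMapC g p).1 : E3) - p.1‖ < ε ∧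
      ‖ambient (tangentMapC g p) - ambient p‖ < ε := by
  have hc : Continuous fun p : TangentBundle (𝓡 2) S2 => ((p.1 : E3), ambient p) :=
    (continuous_subtype_val.comp (FiberBundle.continuous_proj _ _)).prodMk continuous_ambient
  let Φ : C(TangentBundle (𝓡 2) S2, E3 × E3) := ⟨_, hc⟩
  have h1 : Continuous fun g : Diff1 => Φ.comp (tangentMapC g) :=
    (ContinuousMap.continuous_postcomp _).comp continuous_induced_dom
  have h2 := ContinuousMap.tendsto_iff_forall_isCompact_tendstoUniformlyOn.1 (h1.tendsto 1) _
    isCompact_shellTangent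
  have h3 := Metric.tendstoUniformlyOn_iff.1 h2 ε hε
  have hone : tangentMapC 1 = ContinuousMap.id _ := by
    ext1 p
    exact congrFun tangentMap_id p
  filter_upwards [h3] with g hg p hp
  have := hg p hp
  rw [hone, dist_comm, Prod.dist_eq, max_lt_iff, dist_eq_norm, dist_eq_norm] at this
  exact this

theorem eventually_isNearIdentity {ε : ℝ} (hε : 0 < ε) :
    ∀ᶠ g : Diff1 in 𝓝 1, IsNearIdentity ε g := by
  filter_upwards [eventually_near_on_shell (half_pos hε)] with g hg
  have h0 : ∀ x, ‖(g x : E3) - x‖ ≤ ε / 2 := by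
    intro x
    have hx : radialTangent ((x : E3), 0) ∈ shellTangent :=
      ⟨_, ⟨by rw [norm_S2]; norm_num, by rw [norm_S2], by simp⟩, rfl⟩
    have h1 : (radialTangent ((x : E3), 0)).1 = x := toS2_coe x
    have h2 := (hg _ hx).1.le
    have h3 : (tangentMapC g (radialTangent ((x : E3), 0))).1 = g x := congrArg g h1
    rwa [h3, h1] at h2
  refine ⟨fun x => (h0 x).trans (by linarith), fun x p => ?_⟩
  -- For points at distance at least `1`, two displacements of at most `ε / 2` suffice. Otherwise
  -- the mean value inequality is applied to the displacement along the chord.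
  rcases le_total 1 ‖(x : E3) - p‖ with hxp | hxp
  · have e : ((g x : E3) - g p) - ((x : E3) - p) = ((g x : E3) - x) - ((g p : E3) - p) := by abel
    rw [e]
    refine (norm_sub_le _ _).trans ?_
    nlinarith [h0 x, h0 p]
  -- A point of a chord of length at most `1` is within `1 / 2` of one of its ends, so the chord
  -- stays in the shell.
  · have hseg : ∀ Y ∈ segment ℝ (p : E3) x, 1 / 2 ≤ ‖Y‖ ∧ ‖Y‖ ≤ 1 := by
      intro Y hY
      constructor
      · rcases le_total ‖Y - x‖ (1 / 2) with h | h
        · have := norm_sub_norm_le (x : E3) Y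
          rw [norm_S2, norm_sub_rev] at this
          linarith
        · have h1 := norm_sub_norm_le (p : E3) Y
          have h2 := dist_add_dist_of_mem_segment hY
          rw [dist_eq_norm, dist_eq_norm, dist_eq_norm, norm_sub_rev (p : E3) x] at h2
          rw [norm_S2] at h1
          linarith
      · have := (convex_closedBall (0 : E3) 1).segment_subset (x := (p : E3)) (y := x)
          (by simp) (by simp) hY
        simpa using this
    have hder : ∀ Y ∈ segment ℝ (p : E3) x, ∃ A : E3 →L[ℝ] E3,
        HasFDerivAt (fun Y => (g (toS2 Y) : E3) - toS2 Y) A Y ∧ ‖A‖ ≤ ε := by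
      intro Y hY
      obtain ⟨hY1, hY2⟩ := hseg Y hY
      have hY0 : Y ≠ 0 := by
        rintro rfl
        rw [norm_zero] at hY1
        norm_num at hY1
      obtain ⟨A, hA, hA'⟩ := hasFDerivAt_comp_toS2 g hY0
      obtain ⟨B, hB, hB'⟩ := hasFDerivAt_comp_toS2 1 hY0
      refine ⟨A - B, hA.sub hB, ContinuousLinearMap.opNorm_le_of_unit_norm hε.le fun v hv => ?_⟩
      have hone : tangentMapC 1 = ContinuousMap.id _ := by
        ext1 p
        exact congrFun tangentMap_id p
      rw [sub_apply, hA', hB', hone]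
      have := (hg _ ⟨(Y, v), ⟨hY1, hY2, hv.le⟩, rfl⟩).2
      exact this.le.trans (by linarith)
    choose! A hA hA' using hder
    have := (convex_segment (p : E3) x).norm_image_sub_le_of_norm_hasFDerivWithin_le
      (fun Y hY => (hA Y hY).hasFDerivWithinAt) hA' (left_mem_segment ℝ _ _)
      (right_mem_segment ℝ _ _)
    simp only [toS2_coe] at this
    have e : ((g x : E3) - g p) - ((x : E3) - p) = ((g x : E3) - x) - ((g p : E3) - p) := by abel
    rwa [e]

end C1Topology

/-! ### Change of angle and word length -/

section AngleBound

/-- The diffeomorphism `g` changes the total angle that an arc describes around two points by at most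
`C`, if the points are moved along with the arc. -/
def AngleBound (g : Diff1) (C : ℝ) : Prop :=
  ∀ (x y : S2) (δ : ℝ → S2) (s t : ℝ) (θ η : ℝ → ℝ), s ≤ t → ContinuousOn δ (Set.Icc s t) →
    (∀ r ∈ Set.Icc s t, x ≠ δ r ∧ y ≠ δ r) → IsAngleOn (fun r => angular x y (δ r)) s t θ →
    IsAngleOn (fun r => angular (g x) (g y) (g (δ r))) s t η →
    |(η t - η s) - (θ t - θ s)| ≤ C

theorem AngleBound.mono {g : Diff1} {C C' : ℝ} (h : AngleBound g C) (hC : C ≤ C') :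
    AngleBound g C' := fun x y δ s t θ η hst hδ hav hθ hη =>
  (h x y δ s t θ η hst hδ hav hθ hη).trans hC

theorem exists_isAngleOn_angular {x y : S2} {δ : ℝ → S2} {s t : ℝ} (hst : s ≤ t)
    (hδ : ContinuousOn δ (Set.Icc s t)) (hav : ∀ r ∈ Set.Icc s t, x ≠ δ r ∧ y ≠ δ r) :
    ∃ θ, IsAngleOn (fun r => angular x y (δ r)) s t θ :=
  exists_isAngleOn hst ((continuous_angular x y).comp_continuousOn hδ)
    fun r hr => angular_ne_zero (hav r hr).1 (hav r hr).2

theorem AngleBound.one : AngleBound 1 (2 * Real.pi) := by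
  intro x y δ s t θ η hst hδ hav hθ hη
  exact (hη.abs_sub_lt_of_eq_mul hst hθ (fun r hr => angular_ne_zero (hav r hr).1 (hav r hr).2)
    fun r hr => ⟨1, one_pos, by simp [one_apply]⟩).le

/-- The bound for `g` is applied to the arc and the two points already moved by `h`; uniformity over
all pairs of points makes this possible. -/
theorem AngleBound.mul {g h : Diff1} {C C' : ℝ} (hg : AngleBound g C) (hh : AngleBound h C') :
    AngleBound (g * h) (C + C') := by
  intro x y δ s t θ η hst hδ hav hθ hη
  have hav' : ∀ r ∈ Set.Icc s t, h x ≠ h (δ r) ∧ h y ≠ h (δ r) := fun r hr =>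
    ⟨h.injective.ne (hav r hr).1, h.injective.ne (hav r hr).2⟩
  have hδ' : ContinuousOn (fun r => h (δ r)) (Set.Icc s t) := h.continuous.comp_continuousOn hδ
  obtain ⟨κ, hκ⟩ := exists_isAngleOn_angular hst hδ' hav'
  have h1 := hh x y δ s t θ κ hst hδ hav hθ hκ
  have h2 := hg (h x) (h y) (fun r => h (δ r)) s t κ η hst hδ' hav' hκ hη
  have := abs_sub_le (η t - η s) (κ t - κ s) (θ t - θ s)
  linarith

theorem AngleBound.inv {g : Diff1} {C : ℝ} (hg : AngleBound g C) : AngleBound g⁻¹ C := by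
  intro x y δ s t θ η hst hδ hav hθ hη
  have hinv : ∀ z, g (g⁻¹ z) = z := fun z => by rw [← mul_apply, mul_inv_cancel, one_apply]
  have := hg (g⁻¹ x) (g⁻¹ y) (fun r => g⁻¹ (δ r)) s t η θ hst
    ((g⁻¹).continuous.comp_continuousOn hδ)
    (fun r hr => ⟨(g⁻¹).injective.ne (hav r hr).1, (g⁻¹).injective.ne (hav r hr).2⟩) hη
    (by simpa only [hinv] using hθ)
  rwa [abs_sub_comm]

theorem AngleBound.of_isNearIdentity {g : Diff1} (hg : IsNearIdentity (1 / 30) g) :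
    AngleBound g (2 * Real.pi) := by
  intro x y δ s t θ η hst hδ hav hθ hη
  have hs : s ∈ Set.Icc s t := ⟨le_rfl, hst⟩
  exact (hη.abs_sub_lt_of_re hst hθ fun r hr => re_angular_pos hg (hav r hr).1 (hav r hr).2
    (hav s hs).1 (hav s hs).2).le

/-- The diffeomorphisms that change the angles described by arcs by a bounded amount. -/
def boundedAngleSubgroup : Subgroup Diff1 where
  carrier := {g | ∃ C, AngleBound g C}
  one_mem' := ⟨_, AngleBound.one⟩
  mul_mem' := fun ⟨_, hf⟩ ⟨_, hg⟩ => ⟨_, hf.mul hg⟩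
  inv_mem' := fun ⟨_, hf⟩ => ⟨_, hf.inv⟩

/-- Such a subgroup is open, and so are its left cosets; hence it is also closed. Only left
translations need to be continuous. -/
theorem diff1Zero_le_of_mem_nhds {H : Subgroup Diff1} (hH : (H : Set Diff1) ∈ 𝓝 (1 : Diff1)) :
    Diff1Zero ≤ H := by
  have near : ∀ f : Diff1, ∀ᶠ g in 𝓝 f, f⁻¹ * g ∈ H := by
    intro f
    have h := (continuous_mul_left f⁻¹).tendsto f
    rw [inv_mul_cancel] at h
    exact h hH
  have hclopen : IsClopen (H : Set Diff1) := by
    constructor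
    · rw [← isOpen_compl_iff, isOpen_iff_mem_nhds]
      intro f hf
      filter_upwards [near f] with g hg hgH
      have := H.mul_mem hgH (H.inv_mem hg)
      rw [mul_inv_rev, inv_inv, mul_inv_cancel_left] at this
      exact hf this
    · rw [isOpen_iff_mem_nhds]
      intro f hf
      filter_upwards [near f] with g hg
      have := H.mul_mem hf hg
      rwa [mul_inv_cancel_left] at this
  exact hclopen.connectedComponent_subset H.one_mem

theorem exists_angleBound (f : Diff1Zero) : ∃ C, AngleBound (f : Diff1) C :=
  diff1Zero_le_of_mem_nhds (H := boundedAngleSubgroup)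
    ((eventually_isNearIdentity (by norm_num : (0 : ℝ) < 1 / 30)).mono
      fun _ hg => ⟨_, AngleBound.of_isNearIdentity hg⟩) f.2

theorem exists_word {G : Type*} [Group G] {S : Set G} {g : G} (hg : g ∈ Subgroup.closure S) :
    ∃ l : List G, l.length = wordLength S g ∧ (∀ x ∈ l, x ∈ S ∨ x⁻¹ ∈ S) ∧ l.prod = g := by
  rw [← Subgroup.mem_toSubmonoid, Subgroup.closure_toSubmonoid] at hg
  obtain ⟨l, hl, hl'⟩ := Submonoid.exists_list_of_mem_closure hg
  exact Nat.sInf_mem (s := {k | ∃ l : List G, l.length = k ∧ (∀ x ∈ l, x ∈ S ∨ x⁻¹ ∈ S) ∧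
    l.prod = g}) ⟨l.length, l, rfl, hl, hl'⟩

/-- A shortest word is multiplied out letter by letter. The sum over `S` dominates the bound of each
generator, inverses have the same bound, and `2π` accounts for the empty word. -/
theorem exists_angleBound_wordLength (S : Finset Diff1Zero) :
    ∃ C, 0 ≤ C ∧ ∀ g ∈ Subgroup.closure (S : Set Diff1Zero),
      AngleBound (g : Diff1) (C * wordLength (S : Set Diff1Zero) g + 2 * Real.pi) := by
  choose C hC using exists_angleBound
  have hS : ∀ x ∈ S, AngleBound (x : Diff1) (∑ x ∈ S, |C x|) := fun x hx =>
    (hC x).mono ((le_abs_self _).trans (Finset.single_le_sum (f := fun x => |C x|)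
      (fun y _ => abs_nonneg _) hx))
  refine ⟨∑ x ∈ S, |C x|, Finset.sum_nonneg fun _ _ => abs_nonneg _, fun g hg => ?_⟩
  obtain ⟨l, hl, hlS, rfl⟩ := exists_word hg
  rw [← hl]
  clear hl hg
  induction l with
  | nil => simpa using AngleBound.one
  | cons a l ih =>
    have h1 := ih fun x hx => hlS x (List.mem_cons_of_mem _ hx)
    have h2 : AngleBound (a : Diff1) (∑ x ∈ S, |C x|) := by
      rcases hlS a List.mem_cons_self with h | h
      · exact hS a h
      · have := (hS _ h).inv
        rwa [InvMemClass.coe_inv, inv_inv] at this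
    rw [List.prod_cons, Subgroup.coe_mul]
    refine (h2.mul h1).mono (le_of_eq ?_)
    rw [List.length_cons]
    push_cast
    ring

end AngleBound

/-! ### Smooth curves turn by a bounded angle about all pairs of points -/

section SmoothCurves

open ComplexConjugate

/-- The stereographic coordinate from the south pole (`σ = 1`) or the north pole (`σ = -1`) is a
quotient of the two components of `spinor z`. Pulling out one component makes every bracket affine
in it. -/
theorem exists_affine_coordinate {σ : ℝ} (hσ : σ = 1 ∨ σ = -1) :
    ∃ P Q : S2 → ℂ, ∀ z : S2, 1 + σ * (z : E3) 2 ≠ 0 → ∃ k : ℂ, k ≠ 0 ∧ ∀ x, bracket x z =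
      k * (P x + Q x * (((z : E3) 0 + σ * (z : E3) 1 * Complex.I) / (1 + σ * (z : E3) 2))) := by
  rcases hσ with rfl | rfl
  · refine ⟨fun x => -(spinor x).2, fun x => (spinor x).1, fun z hz => ⟨(spinor z).1, ?_, fun x => ?_⟩⟩
    all_goals
      have h11 := spinor_one_one z
      have h21 := spinor_two_one z
      have hz' : ((1 : ℝ) : ℂ) + (1 : ℝ) * (z : E3) 2 ≠ 0 := by exact_mod_cast hz
      simp only [Complex.ofReal_one, one_mul] at hz' ⊢
    · intro h0
      rw [h0, zero_mul] at h11
      exact hz' (by linear_combination -2 * h11)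
    · rw [bracket]
      field_simp
      linear_combination (spinor x).1 * (2 * (spinor z).1 * h21 - 2 * (spinor z).2 * h11)
  · refine ⟨fun x => (spinor x).1, fun x => -(spinor x).2, fun z hz => ⟨(spinor z).2, ?_, fun x => ?_⟩⟩
    all_goals
      have h22 := spinor_two_two z
      have h12 := spinor_one_two z
      have hz' : ((1 : ℝ) : ℂ) + (-1 : ℝ) * (z : E3) 2 ≠ 0 := by exact_mod_cast hz
      simp only [Complex.ofReal_one, Complex.ofReal_neg, neg_mul, one_mul, ← sub_eq_add_neg] at hz' ⊢
    · intro h0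
      rw [h0, zero_mul] at h22
      exact hz' (by linear_combination -2 * h22)
    · rw [bracket]
      field_simp
      linear_combination (spinor x).2 * (2 * (spinor z).1 * h22 - 2 * (spinor z).2 * h12)

/-- The arc of `α` over `[s, t]` describes an angle of at most `C` around any two points that it
avoids. -/
def TurnsAtMost (α : ℝ → S2) (s t C : ℝ) : Prop :=
  ∀ (x y : S2) (θ : ℝ → ℝ), (∀ r ∈ Set.Icc s t, x ≠ α r ∧ y ≠ α r) →
    IsAngleOn (fun r => angular x y (α r)) s t θ → |θ t - θ s| ≤ C

theorem abs_sub_le_of_affine {ζ : ℝ → ℂ} {w : ℂ} (hw : w ≠ 0) {s t : ℝ} (hst : s ≤ t)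
    (hζ : ContinuousOn ζ (Set.Icc s t))
    (hmono : MonotoneOn (fun r => (conj w * ζ r).re) (Set.Icc s t)) {p q : ℂ} {θ : ℝ → ℝ}
    (h0 : ∀ r ∈ Set.Icc s t, p + q * ζ r ≠ 0) (hθ : IsAngleOn (fun r => p + q * ζ r) s t θ) :
    |θ t - θ s| ≤ 4 * Real.pi := by
  have hc : ContinuousOn (fun r => p + q * ζ r) (Set.Icc s t) := by fun_prop
  rcases eq_or_ne q 0 with rfl | hq
  · refine (hθ.abs_sub_lt_of_monotoneOn one_ne_zero hst hc h0 ?_).le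
    intro a _ b _ _
    simp
  -- Multiplication by `q` rotates the direction `w` to `q * w` and scales the projection by `normSq
  -- q`.
  · refine (hθ.abs_sub_lt_of_monotoneOn (mul_ne_zero hq hw) hst hc h0 ?_).le
    have e : ∀ r, (conj (q * w) * (p + q * ζ r)).re =
        (conj (q * w) * p).re + Complex.normSq q * (conj w * ζ r).re := by
      intro r
      rw [← Complex.re_ofReal_mul, ← Complex.add_re, Complex.normSq_eq_conj_mul_self, map_mul]
      ring_nf
    intro a ha b hb hab
    simp only [e]
    have := mul_le_mul_of_nonneg_left (hmono ha hb hab) (Complex.normSq_nonneg q)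
    linarith

/-- Up to the positive factor `normSq k`, `angular x y` is one affine function of `ζ` times the
conjugate of another. Each turns by at most `4π`, and comparing determinations costs `2π`. Neither
constant depends on `x` or `y`. -/
theorem turnsAtMost_of_affine {α : ℝ → S2} {ζ : ℝ → ℂ} {P Q : S2 → ℂ} {w : ℂ} (hw : w ≠ 0) {s t : ℝ}
    (hst : s ≤ t) (hζ : ContinuousOn ζ (Set.Icc s t))
    (hmono : MonotoneOn (fun r => (conj w * ζ r).re) (Set.Icc s t))
    (h : ∀ r ∈ Set.Icc s t, ∃ k : ℂ, k ≠ 0 ∧ ∀ x, bracket x (α r) = k * (P x + Q x * ζ r)) :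
    TurnsAtMost α s t (10 * Real.pi) := by
  intro x y θ hav hθ
  have hne : ∀ z, (∀ r ∈ Set.Icc s t, z ≠ α r) → ∀ r ∈ Set.Icc s t, P z + Q z * ζ r ≠ 0 := by
    intro z hz r hr h0
    obtain ⟨k, -, hk⟩ := h r hr
    apply bracket_ne_zero (hz r hr)
    rw [hk, h0, mul_zero]
  have hx := hne x fun r hr => (hav r hr).1
  have hy := hne y fun r hr => (hav r hr).2
  have hc : ∀ z, ContinuousOn (fun r => P z + Q z * ζ r) (Set.Icc s t) := fun z => by fun_prop
  obtain ⟨a, ha⟩ := exists_isAngleOn hst (hc x) hx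
  obtain ⟨b, hb⟩ := exists_isAngleOn hst (hc y) hy
  have h1 := abs_sub_le_of_affine hw hst hζ hmono hx ha
  have h2 := abs_sub_le_of_affine hw hst hζ hmono hy hb
  have hab : IsAngleOn (fun r => (P x + Q x * ζ r) * conj (P y + Q y * ζ r)) s t
      (fun r => a r - b r) := by
    refine ⟨ha.1.sub hb.1, fun r hr => ?_⟩
    have e1 := ha.2 r hr
    have e2 := congrArg conj (hb.2 r hr)
    rw [map_mul, Complex.conj_ofReal, ← Complex.exp_conj, map_mul, Complex.conj_ofReal,
      Complex.conj_I] at e2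
    simp only at e1 e2 ⊢
    rw [norm_mul, Complex.norm_conj, Complex.ofReal_sub, sub_mul, sub_eq_add_neg, Complex.exp_add]
    conv_lhs => rw [e1, e2]
    push_cast
    ring_nf
  have h3 := hab.abs_sub_lt_of_eq_mul hst hθ
    (fun r hr => mul_ne_zero (hx r hr) ((map_ne_zero _).2 (hy r hr))) fun r hr => by
      obtain ⟨k, hk0, hk⟩ := h r hr
      refine ⟨Complex.normSq k, Complex.normSq_pos.2 hk0, ?_⟩
      rw [angular, hk, hk, Complex.normSq_eq_conj_mul_self, map_mul]
      ring
  rw [abs_le] at h1 h2 ⊢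
  rw [abs_lt] at h3
  constructor <;> linarith [h3.1, h3.2, h1.1, h1.2, h2.1, h2.2]

/-- By compactness finitely many pieces, each subordinate to one of the neighbourhoods, cover `[0,
1]`; their bounds add up. -/
theorem turnsAtMost_of_local {α : ℝ → S2} {B : ℝ} (hB : 0 ≤ B)
    (h : ∀ t₀ ∈ Set.Icc (0 : ℝ) 1, ∃ ε > 0, ∀ s t, s ≤ t → s ∈ Set.Icc (0 : ℝ) 1 →
      t ∈ Set.Icc (0 : ℝ) 1 → |s - t₀| < ε → |t - t₀| < ε → TurnsAtMost α s t B) :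
    ∃ C, ∀ s t, 0 ≤ s → s ≤ t → t ≤ 1 → TurnsAtMost α s t C := by
  choose! ε hε hturn using h
  obtain ⟨τ, hτ0, hτm, ⟨n, hn⟩, hτ⟩ := exists_monotone_Icc_subset_open_cover_unitInterval
    (c := fun i : unitInterval => Metric.ball i (ε i)) (fun i => Metric.isOpen_ball)
    (fun x _ => Set.mem_iUnion.2 ⟨x, Metric.mem_ball_self (hε x x.2)⟩)
  refine ⟨n * B, fun s t hs hst ht x y θ hav hθ => ?_⟩
  -- The subdivision of `[0, 1]` is clamped to `[s, t]`; pieces outside become degenerate and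
  -- contribute nothing.
  let ρ : ℕ → ℝ := fun k => max s (min t (τ k))
  have hρ : ∀ k, ρ k ∈ Set.Icc s t := fun k => ⟨le_max_left _ _, max_le hst (min_le_left _ _)⟩
  have hρm : Monotone ρ := fun i j hij =>
    max_le_max le_rfl (min_le_min le_rfl (hτm hij))
  have h0 : ρ 0 = s := by
    simp only [ρ, hτ0]
    exact max_eq_left ((min_le_right _ _).trans hs)
  have h1 : ρ n = t := by
    simp only [ρ, hn n le_rfl]
    change max s (min t 1) = t
    rw [min_eq_left ht, max_eq_right hst]
  have hstep : ∀ k, |θ (ρ (k + 1)) - θ (ρ k)| ≤ B := by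
    intro k
    rcases (hρm k.le_succ).eq_or_lt with he | hlt
    · rw [← he, sub_self, abs_zero]; exact hB
    have hmem : ∀ r ∈ Set.Icc (ρ k) (ρ (k + 1)), (τ k : ℝ) ≤ r ∧ r ≤ τ (k + 1) := by
      intro r hr
      constructor
      · refine le_trans ?_ hr.1
        rcases le_total (τ k : ℝ) t with h | h
        · simp only [ρ, min_eq_right h]
          exact le_max_right _ _
        · exfalso
          have : ρ k = t := by simp only [ρ, min_eq_left h, max_eq_right hst]
          linarith [(hρ (k + 1)).2]
      · refine hr.2.trans ?_
        rcases le_total s (τ (k + 1) : ℝ) with h | h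
        · exact max_le h (min_le_right _ _)
        · exfalso
          have : ρ (k + 1) = s := max_eq_left ((min_le_right _ _).trans h)
          linarith [(hρ k).1]
    obtain ⟨i, hi⟩ := hτ k
    have hball : ∀ r ∈ Set.Icc (ρ k) (ρ (k + 1)), r ∈ Set.Icc (0 : ℝ) 1 ∧ |r - i| < ε i := by
      intro r hr
      have hr01 : r ∈ Set.Icc (0 : ℝ) 1 :=
        ⟨(τ k).2.1.trans (hmem r hr).1, (hmem r hr).2.trans (τ (k + 1)).2.2⟩
      exact ⟨hr01, hi (show (⟨r, hr01⟩ : unitInterval) ∈ Set.Icc (τ k) (τ (k + 1)) from hmem r hr)⟩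
    have hl := hball _ ⟨le_rfl, hlt.le⟩
    have hr := hball _ ⟨hlt.le, le_rfl⟩
    exact hturn i i.2 (ρ k) (ρ (k + 1)) hlt.le hl.1 hr.1 hl.2 hr.2 x y θ
      (fun r hr => hav r ⟨(hρ k).1.trans hr.1, hr.2.trans (hρ (k + 1)).2⟩)
      (hθ.mono (hρ k).1 (hρ (k + 1)).2)
  have hsum : θ t - θ s = ∑ k ∈ Finset.range n, (θ (ρ (k + 1)) - θ (ρ k)) := by
    rw [Finset.sum_range_sub (fun k => θ (ρ k)), h0, h1]
  rw [hsum]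
  refine (Finset.abs_sum_le_sum_abs _ _).trans ?_
  refine (Finset.sum_le_card_nsmul _ _ B fun k _ => hstep k).trans_eq ?_
  simp

theorem hasDerivWithinAt_coord {α : ℝ → E3} {α' : E3} {s : Set ℝ} {t : ℝ}
    (h : HasDerivWithinAt α α' s t) (i : Fin 3) :
    HasDerivWithinAt (fun r => α r i) (α' i) s t :=
  (EuclideanSpace.proj (𝕜 := ℝ) i).hasFDerivAt.comp_hasDerivWithinAt t h

/-- Stereographic projection is an immersion: `h0` is the vanishing of the numerator in the quotient
rule for its coordinate. -/
theorem stereographic_deriv_ne_zero {σ : ℝ} (hσ : σ = 1 ∨ σ = -1) {a b c a' b' c' : ℝ}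
    (h : a ^ 2 + b ^ 2 + c ^ 2 = 1) (h' : a * a' + b * b' + c * c' = 0) (hc : 1 + σ * c ≠ 0)
    (h0 : ((a' + σ * b' * Complex.I) * (1 + σ * c) - (a + σ * b * Complex.I) * (σ * c') : ℂ) = 0) :
    a' = 0 ∧ b' = 0 ∧ c' = 0 := by
  have hre := congrArg Complex.re h0
  have him := congrArg Complex.im h0
  simp at hre him
  have hσ2 : σ ^ 2 = 1 := by rcases hσ with rfl | rfl <;> norm_num
  have hσ0 : σ ≠ 0 := by rcases hσ with rfl | rfl <;> norm_num
  have hc' : c' = 0 := by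
    have : (1 + σ * c) * c' = 0 := by
      have e : (1 + σ * c) * (a * a' + b * b') = (1 - c ^ 2) * (σ * c') := by
        have e1 : b * b' * (1 + σ * c) = b ^ 2 * (σ * c') := by
          linear_combination b * σ * him + (b ^ 2 * σ * c' - b * b' * (1 + σ * c)) * hσ2
        linear_combination a * hre + e1 + σ * c' * h
      have e2 : (1 + σ * c) * (-(c * c')) = (1 - c ^ 2) * (σ * c') := by
        rw [← e]; linear_combination (1 + σ * c) * (-h')
      linear_combination -σ * e2 - c' * hσ2
    exact (mul_eq_zero.1 this).resolve_left hc
  subst hc'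
  simp at hre him
  exact ⟨hre.resolve_right hc, (him.resolve_right hc).resolve_left hσ0, rfl⟩

/-- In a stereographic coordinate the velocity at `t₀` is nonzero. By continuity the projection onto
its direction is monotone near `t₀`. -/
theorem IsSmoothCurve.exists_turnsAtMost_near {α : ℝ → S2} (hα : IsSmoothCurve α) {t₀ : ℝ}
    (ht₀ : t₀ ∈ Set.Icc (0 : ℝ) 1) : ∃ ε > 0, ∀ s t, s ≤ t → s ∈ Set.Icc (0 : ℝ) 1 →
      t ∈ Set.Icc (0 : ℝ) 1 → |s - t₀| < ε → |t - t₀| < ε → TurnsAtMost α s t (10 * Real.pi) := by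
  obtain ⟨hC1, hne⟩ := hα
  let v : ℝ → E3 := derivWithin (fun t => (α t : E3)) (Set.Icc 0 1)
  have hder : ∀ t ∈ Set.Icc (0 : ℝ) 1,
      HasDerivWithinAt (fun t => (α t : E3)) (v t) (Set.Icc 0 1) t := fun t ht =>
    (hC1.differentiableOn one_ne_zero t ht).hasDerivWithinAt
  have hv : ContinuousOn v (Set.Icc 0 1) :=
    hC1.continuousOn_derivWithin (uniqueDiffOn_Icc zero_lt_one) le_rfl
  have hcoord := fun t ht i => hasDerivWithinAt_coord (hder t ht) i
  have hαi : ∀ i, ContinuousOn (fun t => (α t : E3) i) (Set.Icc 0 1) := fun i t ht =>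
    (hcoord t ht i).continuousWithinAt
  have hvi : ∀ i, ContinuousOn (fun t => v t i) (Set.Icc 0 1) := fun i =>
    (EuclideanSpace.proj (𝕜 := ℝ) i).continuous.comp_continuousOn hv
  -- The pole of projection is taken in the hemisphere opposite to `α t₀`.
  obtain ⟨σ, hσ, hσ0⟩ : ∃ σ : ℝ, (σ = 1 ∨ σ = -1) ∧ 1 + σ * (α t₀ : E3) 2 ≠ 0 := by
    rcases le_total 0 ((α t₀ : E3) 2) with h | h
    · exact ⟨1, Or.inl rfl, by positivity⟩
    · exact ⟨-1, Or.inr rfl, by linarith⟩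
  obtain ⟨P, Q, hPQ⟩ := exists_affine_coordinate hσ
  let A : ℝ → ℂ := fun t => 1 + σ * (α t : E3) 2
  let B : ℝ → ℂ := fun t => (α t : E3) 0 + σ * (α t : E3) 1 * Complex.I
  let A' : ℝ → ℂ := fun t => σ * v t 2
  let B' : ℝ → ℂ := fun t => v t 0 + σ * v t 1 * Complex.I
  have hA : ∀ t ∈ Set.Icc (0 : ℝ) 1, HasDerivWithinAt A (A' t) (Set.Icc 0 1) t := fun t ht =>
    (((hcoord t ht 2).ofReal_comp).const_mul (σ : ℂ)).const_add 1
  have hB : ∀ t ∈ Set.Icc (0 : ℝ) 1, HasDerivWithinAt B (B' t) (Set.Icc 0 1) t := fun t ht =>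
    ((hcoord t ht 0).ofReal_comp).add
      ((((hcoord t ht 1).ofReal_comp).const_mul (σ : ℂ)).mul_const Complex.I)
  have hA0 : ∀ t, 1 + σ * (α t : E3) 2 ≠ 0 ↔ A t ≠ 0 := fun t => by
    simp only [A]; norm_cast
  have hAc : ContinuousOn A (Set.Icc 0 1) := fun t ht => (hA t ht).continuousWithinAt
  have hBc : ContinuousOn B (Set.Icc 0 1) := fun t ht => (hB t ht).continuousWithinAt
  have hA'c : ContinuousOn A' (Set.Icc 0 1) :=
    continuousOn_const.mul (Complex.continuous_ofReal.comp_continuousOn (hvi 2))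
  have hB'c : ContinuousOn B' (Set.Icc 0 1) :=
    (Complex.continuous_ofReal.comp_continuousOn (hvi 0)).add
      ((continuousOn_const.mul (Complex.continuous_ofReal.comp_continuousOn (hvi 1))).mul
        continuousOn_const)
  -- This is the derivative of the stereographic coordinate `B / A`.
  let D : ℝ → ℂ := fun t => (B' t * A t - B t * A' t) / A t ^ 2
  have hDc : ContinuousWithinAt D (Set.Icc 0 1) t₀ :=
    (((hB'c.mul hAc).sub (hBc.mul hA'c)) t₀ ht₀).div ((hAc.pow 2) t₀ ht₀)
      (pow_ne_zero 2 ((hA0 t₀).1 hσ0))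
  have hD0 : D t₀ ≠ 0 := by
    intro h0
    have hnum := (div_eq_zero_iff.1 h0).resolve_right (pow_ne_zero 2 ((hA0 t₀).1 hσ0))
    have hunit := sq_add_sq_add_sq_S2 (α t₀)
    have htan : (α t₀ : E3) 0 * v t₀ 0 + (α t₀ : E3) 1 * v t₀ 1 + (α t₀ : E3) 2 * v t₀ 2 = 0 := by
      have h1 := (((hcoord t₀ ht₀ 0).pow 2).add ((hcoord t₀ ht₀ 1).pow 2)).add
        ((hcoord t₀ ht₀ 2).pow 2)
      have h2 : HasDerivWithinAt (fun _ : ℝ => (1 : ℝ)) 0 (Set.Icc 0 1) t₀ :=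
        hasDerivWithinAt_const _ _ _
      have h3 := (uniqueDiffOn_Icc zero_lt_one t₀ ht₀).eq_deriv _
        (h1.congr (fun t _ => (sq_add_sq_add_sq_S2 (α t)).symm) hunit.symm) h2
      simp only [Nat.cast_ofNat] at h3
      norm_num at h3
      linarith
    obtain ⟨h1, h2, h3⟩ := stereographic_deriv_ne_zero hσ hunit htan hσ0 hnum
    apply hne t₀ ht₀
    ext i
    fin_cases i
    · exact h1
    · exact h2
    · exact h3
  have hpos : 0 < (conj (D t₀) * D t₀).re := by
    rw [← Complex.normSq_eq_conj_mul_self, Complex.ofReal_re]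
    exact Complex.normSq_pos.2 hD0
  have hcont : ContinuousWithinAt (fun t => (conj (D t₀) * D t).re) (Set.Icc 0 1) t₀ :=
    Complex.continuous_re.continuousAt.comp_continuousWithinAt (continuousWithinAt_const.mul hDc)
  have hev : ∀ᶠ t in 𝓝[Set.Icc 0 1] t₀, A t ≠ 0 ∧ 0 < (conj (D t₀) * D t).re :=
    ((hAc t₀ ht₀).eventually_ne ((hA0 t₀).1 hσ0)).and (hcont.eventually_const_lt hpos)
  obtain ⟨ε, hε, hball⟩ := Metric.mem_nhdsWithin_iff.1 hev
  refine ⟨ε, hε, fun s t hst hs ht hsε htε => ?_⟩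
  have hgood : ∀ r ∈ Set.Icc s t, r ∈ Set.Icc (0 : ℝ) 1 ∧ A r ≠ 0 ∧
      0 < (conj (D t₀) * D r).re := by
    intro r hr
    have hr01 : r ∈ Set.Icc (0 : ℝ) 1 := ⟨hs.1.trans hr.1, hr.2.trans ht.2⟩
    refine ⟨hr01, hball ⟨?_, hr01⟩⟩
    rw [abs_lt] at hsε htε
    rw [Metric.mem_ball, Real.dist_eq, abs_lt]
    constructor <;> linarith [hr.1, hr.2]
  have hsub : Set.Icc s t ⊆ Set.Icc 0 1 := fun r hr => (hgood r hr).1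
  have hζ : ∀ r ∈ Set.Icc s t, HasDerivWithinAt (fun r => B r / A r) (D r) (Set.Icc s t) r :=
    fun r hr => ((hB r (hsub hr)).div (hA r (hsub hr)) (hgood r hr).2.1).mono hsub
  have hζc : ContinuousOn (fun r => B r / A r) (Set.Icc s t) := fun r hr =>
    (hζ r hr).continuousWithinAt
  have hmono : MonotoneOn (fun r => (conj (D t₀) * (B r / A r)).re) (Set.Icc s t) := by
    refine monotoneOn_of_hasDerivWithinAt_nonneg (f' := fun r => (conj (D t₀) * D r).re)
      (convex_Icc s t) ?_ (fun r hr => ?_) fun r hr => ?_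
    · exact Complex.continuous_re.comp_continuousOn (continuousOn_const.mul hζc)
    · exact Complex.reCLM.hasFDerivAt.comp_hasDerivWithinAt r
        (((hζ r (interior_subset hr)).mono interior_subset).const_mul (conj (D t₀)))
    · exact (hgood r (interior_subset hr)).2.2.le
  exact turnsAtMost_of_affine hD0 hst hζc hmono fun r hr => hPQ (α r) ((hA0 r).2 (hgood r hr).2.1)

theorem IsSmoothCurve.exists_turnsAtMost {α : ℝ → S2} (hα : IsSmoothCurve α) :
    ∃ C, ∀ s t, 0 ≤ s → s ≤ t → t ≤ 1 → TurnsAtMost α s t C :=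
  turnsAtMost_of_local (mul_nonneg (by norm_num) Real.pi_pos.le)
    fun _ ht₀ => hα.exists_turnsAtMost_near ht₀

/-- For one pair of points off the curve, a single determination on `[0, 1]` is bounded, and any
other is compared with it. -/
theorem exists_angle_bound_of_avoid {α : ℝ → S2} (hα : ContinuousOn α (Set.Icc 0 1)) {x y : S2}
    (hav : ∀ r ∈ Set.Icc (0 : ℝ) 1, x ≠ α r ∧ y ≠ α r) :
    ∃ C, ∀ s t θ, 0 ≤ s → s ≤ t → t ≤ 1 → IsAngleOn (fun r => angular x y (α r)) s t θ →
      |θ t - θ s| ≤ C := by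
  obtain ⟨η, hη⟩ := exists_isAngleOn_angular zero_le_one hα hav
  obtain ⟨M, hM⟩ := isCompact_Icc.exists_bound_of_continuousOn hη.1
  refine ⟨2 * M + 2 * Real.pi, fun s t θ hs hst ht hθ => ?_⟩
  have h1 := hθ.abs_sub_lt_of_eq_mul hst (hη.mono hs ht)
    (fun r hr => angular_ne_zero (hav r ⟨hs.trans hr.1, hr.2.trans ht⟩).1
      (hav r ⟨hs.trans hr.1, hr.2.trans ht⟩).2) fun r hr => ⟨1, one_pos, by simp⟩
  have h2 := hM s ⟨hs, hst.trans ht⟩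
  have h3 := hM t ⟨hs.trans hst, ht⟩
  rw [Real.norm_eq_abs, abs_le] at h2 h3
  rw [abs_lt] at h1
  rw [abs_le]
  constructor <;> linarith [h1.1, h1.2, h2.1, h2.2, h3.1, h3.2]

end SmoothCurves

/-! ### The angle on the blown-up annulus and on the strip -/

noncomputable section AngularCoordinate

variable {z₀ z₁ : S2}

/-- A nowhere vanishing function on the blown-up annulus that is a positive multiple of
`angular z₀ z₁` away from the boundary. -/
def blowUpAngular (p : BlowUp z₀ z₁) : ℂ := angularLin z₀ z₁ (p.1.2.1 + p.1.2.2)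

theorem continuous_blowUpAngular : Continuous (blowUpAngular (z₀ := z₀) (z₁ := z₁)) :=
  (continuous_angularLin z₀ z₁).comp (by fun_prop)

theorem norm_mul_angularLin_left (p : BlowUp z₀ z₁) :
    (‖((blowDown p : S2) : E3) - z₀‖ : ℂ) * angularLin z₀ z₁ p.1.2.1 =
      angular z₀ z₁ (blowDown p) := by
  rw [← angularLin_smul, ← angularLin_sub_left]
  congr 1
  exact p.2.1.2.1.symm

theorem norm_mul_angularLin_right (p : BlowUp z₀ z₁) :
    (‖((blowDown p : S2) : E3) - z₁‖ : ℂ) * angularLin z₀ z₁ p.1.2.2 =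
      angular z₀ z₁ (blowDown p) := by
  rw [← angularLin_smul, ← angularLin_sub_right]
  congr 1
  exact p.2.2.2.1.symm

theorem norm_sub_pos {x y : S2} (h : x ≠ y) : 0 < ‖(x : E3) - y‖ :=
  norm_pos_iff.2 (sub_ne_zero.2 fun h2 => h (Subtype.ext h2))

/-- On each of the two direction vectors the linear part is `angular` divided by the distance to the
corresponding point, and the two quotients are added. -/
theorem exists_blowUpAngular_eq (p : BlowUp z₀ z₁) (h0 : blowDown p ≠ z₀) (h1 : blowDown p ≠ z₁) :
    ∃ k : ℝ, 0 < k ∧ blowUpAngular p = k * angular z₀ z₁ (blowDown p) := by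
  have h0' := norm_sub_pos h0
  have h1' := norm_sub_pos h1
  refine ⟨‖((blowDown p : S2) : E3) - z₀‖⁻¹ + ‖((blowDown p : S2) : E3) - z₁‖⁻¹, by positivity, ?_⟩
  have e0 := norm_mul_angularLin_left p
  have e1 := norm_mul_angularLin_right p
  have hc0 : (‖((blowDown p : S2) : E3) - z₀‖ : ℂ) ≠ 0 := by exact_mod_cast h0'.ne'
  have hc1 : (‖((blowDown p : S2) : E3) - z₁‖ : ℂ) ≠ 0 := by exact_mod_cast h1'.ne'
  rw [blowUpAngular, angularLin_add]
  push_cast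
  rw [add_mul]
  nth_rewrite 1 [← e0]
  rw [← e1, inv_mul_cancel_left₀ hc0, inv_mul_cancel_left₀ hc1]

theorem angularLin_ne_zero (hz : z₀ ≠ z₁) {w : E3} (hw : ‖w‖ = 1)
    (h : ⟪w, (z₀ : E3)⟫_ℝ = 0 ∨ ⟪w, (z₁ : E3)⟫_ℝ = 0) : angularLin z₀ z₁ w ≠ 0 := by
  rw [← Complex.normSq_pos, normSq_angularLin, ← norm_sq_coord, ← inner_coord, ← inner_coord,
    ← inner_coord, hw, mul_assoc]
  have h1 : ⟪w, (z₀ : E3)⟫_ℝ * ⟪w, (z₁ : E3)⟫_ℝ = 0 := mul_eq_zero.2 h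
  have h2 := norm_sub_sq_real (z₀ : E3) z₁
  rw [norm_S2, norm_S2] at h2
  have h3 := pow_pos (norm_sub_pos hz) 2
  rw [h1]
  linarith

/-- Over `z₀` the direction from `z₁` contributes zero, and the linear part is nonzero on the
tangent direction; the situation over `z₁` is symmetric. -/
theorem blowUpAngular_ne_zero (hz : z₀ ≠ z₁) (p : BlowUp z₀ z₁) : blowUpAngular p ≠ 0 := by
  have e0 := norm_mul_angularLin_left p
  have e1 := norm_mul_angularLin_right p
  rw [blowUpAngular, angularLin_add]
  by_cases h0 : blowDown p = z₀
  · have hc : (‖((blowDown p : S2) : E3) - z₁‖ : ℂ) ≠ 0 := by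
      rw [h0]; exact_mod_cast (norm_sub_pos hz).ne'
    have ha : angular z₀ z₁ (blowDown p) = 0 := by rw [h0, angular_left]
    rw [ha] at e1
    rw [(mul_eq_zero.1 e1).resolve_left hc, add_zero]
    exact angularLin_ne_zero hz p.2.1.1 (Or.inl (p.2.1.2.2 h0))
  by_cases h1 : blowDown p = z₁
  · have hc : (‖((blowDown p : S2) : E3) - z₀‖ : ℂ) ≠ 0 := by
      rw [h1]; exact_mod_cast (norm_sub_pos hz.symm).ne'
    have ha : angular z₀ z₁ (blowDown p) = 0 := by rw [h1, angular_right]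
    rw [ha] at e0
    rw [(mul_eq_zero.1 e0).resolve_left hc, zero_add]
    exact angularLin_ne_zero hz p.2.2.1 (Or.inr (p.2.2.2.2 h1))
  · obtain ⟨k, hk, he⟩ := exists_blowUpAngular_eq p h0 h1
    rw [← angularLin_add]
    change blowUpAngular p ≠ 0
    rw [he]
    exact mul_ne_zero (by exact_mod_cast hk.ne') (angular_ne_zero (Ne.symm h0) (Ne.symm h1))

/-- The argument of `blowUpAngular` has no continuous determination on the annulus. -/
theorem not_exists_continuous_angle (hz : z₀ ≠ z₁) (Θ : BlowUp z₀ z₁ → ℝ) (hΘ : Continuous Θ)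
    (h : ∀ p, blowUpAngular p = ‖blowUpAngular p‖ * Complex.exp (Θ p * Complex.I)) : False := by
  obtain ⟨L, hL⟩ := exists_tangentFrame z₀
  let v₀ : E3 := ‖(z₀ : E3) - z₁‖⁻¹ • ((z₀ : E3) - z₁)
  have hpos := norm_sub_pos hz
  have hmem : ∀ t : ℝ, (z₀, L (Circle.exp t : ℂ), v₀) ∈ blowUpSet z₀ z₁ := by
    intro t
    refine ⟨⟨?_, by simp, fun _ => (hL _).1 ⟨_, rfl⟩⟩, ?_, ?_, fun h => absurd h hz⟩
    · rw [L.norm_map]; exact Circle.norm_coe _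
    · rw [norm_smul, norm_inv, norm_norm, inv_mul_cancel₀ hpos.ne']
    · rw [smul_smul, mul_inv_cancel₀ hpos.ne', one_smul]
  let c : ℝ → BlowUp z₀ z₁ := fun t => ⟨_, hmem t⟩
  have hc : Continuous c := by
    refine Continuous.subtype_mk (continuous_const.prodMk (Continuous.prodMk ?_ continuous_const)) _
    exact L.continuous.comp (by fun_prop)
  have hv₀ : angularLin z₀ z₁ v₀ = 0 := by
    rw [angularLin_smul, angularLin_sub_right, angular_left, mul_zero]
  -- On the boundary circle `c` over `z₀`, antipodal points have opposite values.
  have hneg : ∀ t, blowUpAngular (c (t + Real.pi)) = -blowUpAngular (c t) := by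
    intro t
    have e : (Circle.exp (t + Real.pi) : ℂ) = (-1 : ℝ) • (Circle.exp t : ℂ) := by
      rw [Circle.coe_exp, Circle.coe_exp]
      push_cast
      rw [add_mul, Complex.exp_add, Complex.exp_pi_mul_I]
      simp
    simp only [blowUpAngular, angularLin_add, c, hv₀, add_zero]
    rw [e, map_smul, angularLin_smul]
    simp
  have hper : c (0 + Real.pi + Real.pi) = c 0 := by
    apply Subtype.ext
    simp only [c]
    rw [zero_add, ← two_mul, Circle.exp_two_pi, Circle.exp_zero]
  have hne : ∀ t, Θ (c (t + Real.pi)) - Θ (c t) ≠ 0 := by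
    intro t h0
    have h1 := h (c (t + Real.pi))
    rw [sub_eq_zero.1 h0, hneg, norm_neg, ← h (c t)] at h1
    exact blowUpAngular_ne_zero hz (c t) (self_eq_neg.1 h1.symm)
  have hcont : Continuous fun t => Θ (c (t + Real.pi)) - Θ (c t) := by fun_prop
  -- The antipodal differences at `0` and `π` are negatives of each other, so some difference
  -- vanishes, contradicting `hne`.
  have h0 : (0 : ℝ) ∈ Set.uIcc (Θ (c (0 + Real.pi)) - Θ (c 0))
      (Θ (c (0 + Real.pi + Real.pi)) - Θ (c (0 + Real.pi))) := by
    rw [hper, Set.mem_uIcc]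
    rcases le_total (Θ (c (0 + Real.pi))) (Θ (c 0)) with h | h
    · left; constructor <;> linarith
    · right; constructor <;> linarith
  obtain ⟨t, -, ht⟩ := intermediate_value_uIcc (a := 0) (b := 0 + Real.pi) hcont.continuousOn h0
  exact hne t ht

theorem exists_continuous_angle_strip (F : Strip → ℂ) (hF : Continuous F) (h0 : ∀ p, F p ≠ 0) :
    ∃ θ : Strip → ℝ, Continuous θ ∧ ∀ p, F p = ‖F p‖ * Complex.exp (θ p * Complex.I) := by
  obtain ⟨θ, hθ, h⟩ := exists_continuous_angle
    (fun q : ℝ × ℝ => F (q.1, Set.projIcc 0 1 zero_le_one q.2))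
    (hF.comp (continuous_fst.prodMk (continuous_projIcc.comp continuous_snd))) fun _ => h0 _
  refine ⟨fun p => θ (p.1, p.2), by fun_prop, fun p => ?_⟩
  have := h (p.1, p.2)
  rwa [Set.projIcc_val] at this

theorem translate_add (i j : ℤ) (p : Strip) : translate (i + j) p = translate i (translate j p) := by
  simp only [translate, Int.cast_add, Prod.mk.injEq, and_true]
  ring

theorem apply_translate_of_one {f : Strip → ℝ} (h : ∀ p, f (translate 1 p) = f p) (i : ℤ)
    (p : Strip) : f (translate i p) = f p := by
  induction i using Int.induction_on with
  | zero => simp [translate]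
  | succ n ih => rw [add_comm, translate_add, h, ih]
  | pred n ih => rw [← h, ← translate_add, ← ih]; congr 2; ring

theorem IsUniversalCover.apply_translate {π : Strip → BlowUp z₀ z₁} (hπ : IsUniversalCover z₀ z₁ π)
    (i : ℤ) (p : Strip) : π (translate i p) = π p :=
  ((hπ.apply_eq_iff p (translate i p)).2 ⟨i, rfl⟩).symm

/-- The angle increases by a constant `2πk` under the translation `T`, so subtracting `2πk` times
the first coordinate leaves a periodic, hence bounded, function. Only `k ≠ 0` is needed. -/
theorem IsUniversalCover.exists_angle (hz : z₀ ≠ z₁) {π : Strip → BlowUp z₀ z₁}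
    (hπ : IsUniversalCover z₀ z₁ π) : ∃ (θ : Strip → ℝ) (K : ℝ), Continuous θ ∧
      (∀ p, blowUpAngular (π p) = ‖blowUpAngular (π p)‖ * Complex.exp (θ p * Complex.I)) ∧
      ∀ p q : Strip, |p.1 - q.1| ≤ |θ p - θ q| + K := by
  obtain ⟨θ, hθ, hexp⟩ := exists_continuous_angle_strip (fun p => blowUpAngular (π p))
    (continuous_blowUpAngular.comp hπ.isCoveringMap.continuous)
    (fun p => blowUpAngular_ne_zero hz (π p))
  have hpi := Real.two_pi_pos
  have htr : Continuous (translate 1) := by unfold translate; fun_prop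
  have hint : ∀ p, ∃ n : ℤ, (θ (translate 1 p) - θ p) / (2 * Real.pi) = n := by
    intro p
    have h1 := hexp (translate 1 p)
    rw [hπ.apply_translate, hexp p] at h1
    have hn : (‖blowUpAngular (π p)‖ : ℂ) ≠ 0 := by
      exact_mod_cast norm_ne_zero_iff.2 (blowUpAngular_ne_zero hz (π p))
    simp only [norm_mul, Complex.norm_real, norm_norm, Complex.norm_exp_ofReal_mul_I,
      mul_one] at h1
    obtain ⟨n, hn⟩ := Complex.exp_eq_exp_iff_exists_int.1 (mul_left_cancel₀ hn h1)
    refine ⟨-n, ?_⟩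
    have h2 : (θ p : ℂ) = θ (translate 1 p) + n * (2 * Real.pi) :=
      mul_right_cancel₀ Complex.I_ne_zero (by linear_combination hn)
    have h3 : θ p = θ (translate 1 p) + n * (2 * Real.pi) := by exact_mod_cast h2
    rw [h3]
    field_simp
    push_cast
    ring
  choose n hn using hint
  have hnc : Continuous n := by
    rw [Int.isClosedEmbedding_coe_real.isInducing.continuous_iff]
    have : ((↑) : ℤ → ℝ) ∘ n = fun p => (θ (translate 1 p) - θ p) / (2 * Real.pi) :=
      funext fun p => (hn p).symm
    rw [this]
    fun_prop
  obtain ⟨k, hk⟩ : ∃ k : ℤ, ∀ p, θ (translate 1 p) = θ p + 2 * Real.pi * k := by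
    refine ⟨n (0, 0), fun p => ?_⟩
    rw [PreconnectedSpace.constant inferInstance hnc (x := (0, 0)) (y := p), ← hn p]
    field_simp
    ring
  -- If `k = 0`, the angle would descend to a continuous angle on the annulus.
  have hk0 : k ≠ 0 := by
    rintro rfl
    simp only [Int.cast_zero, mul_zero, add_zero] at hk
    have hq : Topology.IsQuotientMap π := hπ.isCoveringMap.isQuotientMap hπ.surjective
    have hfac : ∀ p q, π p = π q → (⟨θ, hθ⟩ : C(Strip, ℝ)) p = (⟨θ, hθ⟩ : C(Strip, ℝ)) q := by
      intro p q hpq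
      obtain ⟨i, rfl⟩ := (hπ.apply_eq_iff p q).1 hpq
      exact (apply_translate_of_one hk i p).symm
    let Θ : C(BlowUp z₀ z₁, ℝ) := hq.lift (f := ⟨π, hq.continuous⟩) ⟨θ, hθ⟩ hfac
    have hΘ : ∀ p, Θ (π p) = θ p := fun p => DFunLike.congr_fun (hq.lift_comp (f := ⟨π, hq.continuous⟩) ⟨θ, hθ⟩ hfac) p
    refine not_exists_continuous_angle hz Θ Θ.continuous fun x => ?_
    obtain ⟨p, rfl⟩ := hπ.surjective x
    rw [hΘ]
    exact hexp p
  let f : Strip → ℝ := fun p => θ p - 2 * Real.pi * k * p.1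
  have hf : Continuous f := by fun_prop
  have hf1 : ∀ p, f (translate 1 p) = f p := by
    intro p
    simp only [f, hk]
    simp only [translate, Int.cast_one]
    ring
  obtain ⟨M, hM⟩ := (isCompact_Icc.prod isCompact_univ :
    IsCompact (Set.Icc (0 : ℝ) 1 ×ˢ (Set.univ : Set unitInterval))).exists_bound_of_continuousOn
      hf.continuousOn
  have hfM : ∀ p, |f p| ≤ M := by
    intro p
    rw [← apply_translate_of_one hf1 (-⌊p.1⌋) p]
    refine hM _ ⟨?_, trivial⟩
    have h1 := Int.floor_le p.1
    have h2 := Int.lt_floor_add_one p.1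
    simp only [translate, Int.cast_neg]
    constructor <;> linarith
  refine ⟨θ, 2 * M, hθ, hexp, fun p q => ?_⟩
  have hk1 : (1 : ℝ) ≤ |(k : ℝ)| := by exact_mod_cast Int.one_le_abs hk0
  have h1 : |2 * Real.pi * k * (p.1 - q.1)| ≤ |θ p - θ q| + 2 * M := by
    have e : 2 * Real.pi * k * (p.1 - q.1) = (θ p - θ q) - (f p - f q) := by simp only [f]; ring
    rw [e]
    have h2 := abs_sub (θ p - θ q) (f p - f q)
    have h3 := abs_sub (f p) (f q)
    linarith [hfM p, hfM q]
  refine le_trans ?_ h1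
  rw [abs_mul, abs_mul, abs_of_pos hpi]
  have : 1 ≤ 2 * Real.pi * |(k : ℝ)| := by nlinarith [Real.pi_gt_three]
  nlinarith [abs_nonneg (p.1 - q.1)]

end AngularCoordinate

/-! ### Widths of lifts -/

section Lifts

theorem contDiffOn_comp_toS2 (g : Diff1) :
    ContDiffOn ℝ 1 (fun X : E3 => (g (toS2 X) : E3)) {0}ᶜ :=
  ((contMDiff_coe_sphere (m := 1)).comp g.contMDiff |>.comp_contMDiffOn contMDiffOn_toS2).contDiffOn

theorem IsSmoothCurve.comp {α : ℝ → S2} (hα : IsSmoothCurve α) (g : Diff1) :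
    IsSmoothCurve fun t => g (α t) := by
  have hne : ∀ z : S2, (z : E3) ∈ ({0}ᶜ : Set E3) := fun z => ne_zero_of_mem_unit_sphere z
  have comp_eq : ∀ (h : Diff1) (δ : ℝ → S2), (fun t => (h (δ t) : E3)) =
      (fun X : E3 => (h (toS2 X) : E3)) ∘ fun t => (δ t : E3) := by
    intro h δ
    funext t
    simp only [Function.comp, toS2_coe]
  have hC1 : ContDiffOn ℝ 1 (fun t => (g (α t) : E3)) (Set.Icc 0 1) := by
    rw [comp_eq]
    exact (contDiffOn_comp_toS2 g).comp hα.1 fun t _ => hne (α t)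
  refine ⟨hC1, fun t ht h0 => hα.2 t ht ?_⟩
  have h1 : HasDerivWithinAt (fun t => (g (α t) : E3)) 0 (Set.Icc 0 1) t :=
    h0 ▸ (hC1.differentiableOn one_ne_zero t ht).hasDerivWithinAt
  have h2 : DifferentiableAt ℝ (fun X : E3 => (g⁻¹ (toS2 X) : E3)) (g (α t)) :=
    ((contDiffOn_comp_toS2 g⁻¹).differentiableOn one_ne_zero _ (hne _)).differentiableAt
      (isOpen_compl_singleton.mem_nhds (hne _))
  have h3 := h2.hasFDerivAt.comp_hasDerivWithinAt t h1
  rw [map_zero, ← comp_eq g⁻¹ fun t => g (α t)] at h3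
  have h4 : ∀ z, g⁻¹ (g z) = z := fun z => by rw [← mul_apply, inv_mul_cancel, one_apply]
  simp only [h4] at h3
  exact h3.derivWithin (uniqueDiffOn_Icc zero_lt_one t ht)

/-- The slopes from the right give `v = ‖v‖ • u r`, those from the left the opposite sign. -/
theorem deriv_eq_zero_of_continuous_direction {E : Type*} [NormedAddCommGroup E] [NormedSpace ℝ E]
    {δ u : ℝ → E} {v : E} {r : ℝ} (hδ : HasDerivAt δ v r) (hu : ContinuousAt u r)
    (h : ∀ᶠ a in 𝓝 r, δ a - δ r = ‖δ a - δ r‖ • u a) : v = 0 := by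
  have hs := hasDerivAt_iff_tendsto_slope.1 hδ
  have hr : v = ‖v‖ • u r := by
    have h1 := hs.mono_left (nhdsGT_le_nhdsNE r)
    refine tendsto_nhds_unique h1 ((h1.norm.smul (hu.mono_left nhdsWithin_le_nhds)).congr' ?_)
    filter_upwards [nhdsWithin_le_nhds h, self_mem_nhdsWithin] with a ha (hra : r < a)
    have hp : 0 < (a - r)⁻¹ := inv_pos.2 (sub_pos.2 hra)
    rw [slope_def_module, norm_smul, Real.norm_of_nonneg hp.le, mul_smul, ← ha]
  have hl : v = -(‖v‖ • u r) := by
    have h1 := hs.mono_left (nhdsLT_le_nhdsNE r)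
    refine tendsto_nhds_unique h1 ((h1.norm.smul (hu.mono_left nhdsWithin_le_nhds)).neg.congr' ?_)
    filter_upwards [nhdsWithin_le_nhds h, self_mem_nhdsWithin] with a ha (hra : a < r)
    have hp : (a - r)⁻¹ ≤ 0 := inv_nonpos.2 (sub_nonpos.2 hra.le)
    rw [slope_def_module, norm_smul, Real.norm_of_nonpos hp, mul_smul, ← ha, neg_smul, neg_neg]
  rw [← hr] at hl
  have h2 : (2 : ℝ) • v = 0 := by rw [two_smul, add_eq_zero_iff_eq_neg]; exact hl
  exact (smul_eq_zero.1 h2).resolve_left two_ne_zero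

variable {z₀ z₁ : S2}

/-- A smooth curve running through `z₀` or `z₁` reverses its direction seen from that point, so it
has no continuous lift across the passage. -/
theorem IsSmoothCurve.ne_of_isLift {π : Strip → BlowUp z₀ z₁} (hπ : IsUniversalCover z₀ z₁ π)
    {δ : ℝ → S2} (hδ : IsSmoothCurve δ) {s t : ℝ} (hs : 0 ≤ s) (ht : t ≤ 1) {d : ℝ → Strip}
    (hd : IsLift π δ s t d) {r : ℝ} (hr : r ∈ Set.Ioo s t) : z₀ ≠ δ r ∧ z₁ ≠ δ r := by
  have hr01 : r ∈ Set.Ioo (0 : ℝ) 1 := ⟨hs.trans_lt hr.1, hr.2.trans_le ht⟩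
  have hder : HasDerivAt (fun t => (δ t : E3)) (derivWithin (fun t => (δ t : E3)) (Set.Icc 0 1) r) r :=
    (hδ.1.differentiableOn one_ne_zero r (Set.Ioo_subset_Icc_self hr01)).hasDerivWithinAt.hasDerivAt
      (Icc_mem_nhds hr01.1 hr01.2)
  have hne := hδ.2 r (Set.Ioo_subset_Icc_self hr01)
  have hc : ContinuousAt (fun a => π (d a)) r :=
    hπ.isCoveringMap.continuous.continuousAt.comp
      (hd.1.continuousAt (Icc_mem_nhds hr.1 hr.2))
  constructor
  · intro h0
    have hu : ContinuousAt (fun a => (π (d a)).1.2.1) r :=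
      (by fun_prop : Continuous fun p : BlowUp z₀ z₁ => p.1.2.1).continuousAt.comp hc
    refine hne (deriv_eq_zero_of_continuous_direction hder hu ?_)
    filter_upwards [Icc_mem_nhds hr.1 hr.2] with a ha
    rw [← h0, ← hd.2 a ha]
    exact (π (d a)).2.1.2.1
  · intro h0
    have hu : ContinuousAt (fun a => (π (d a)).1.2.2) r :=
      (by fun_prop : Continuous fun p : BlowUp z₀ z₁ => p.1.2.2).continuousAt.comp hc
    refine hne (deriv_eq_zero_of_continuous_direction hder hu ?_)
    filter_upwards [Icc_mem_nhds hr.1 hr.2] with a ha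
    rw [← h0, ← hd.2 a ha]
    exact (π (d a)).2.2.2.1

theorem IsLift.isAngleOn {π : Strip → BlowUp z₀ z₁} {θ : Strip → ℝ} (hθ : Continuous θ)
    (hexp : ∀ p, blowUpAngular (π p) = ‖blowUpAngular (π p)‖ * Complex.exp (θ p * Complex.I))
    {δ : ℝ → S2} {s t : ℝ} {d : ℝ → Strip} (hd : IsLift π δ s t d)
    (hav : ∀ r ∈ Set.Icc s t, z₀ ≠ δ r ∧ z₁ ≠ δ r) :
    IsAngleOn (fun r => angular z₀ z₁ (δ r)) s t fun r => θ (d r) := by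
  refine ⟨hθ.comp_continuousOn hd.1, fun r hr => ?_⟩
  have h := hd.2 r hr
  obtain ⟨k, hk, hk'⟩ := exists_blowUpAngular_eq (π (d r)) (h ▸ (hav r hr).1.symm)
    (h ▸ (hav r hr).2.symm)
  have h1 := hexp (d r)
  rw [hk', h, norm_mul, Complex.norm_real, Real.norm_of_nonneg hk.le, Complex.ofReal_mul,
    mul_assoc] at h1
  exact mul_left_cancel₀ (by exact_mod_cast hk.ne') h1

/-- The arcs of `δ` that avoid `z₀` and `z₁` describe an angle of at most `B` around these points. -/
def WindsAtMost (z₀ z₁ : S2) (δ : ℝ → S2) (B : ℝ) : Prop :=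
  ∀ s t θ, 0 ≤ s → s ≤ t → t ≤ 1 → (∀ r ∈ Set.Icc s t, z₀ ≠ δ r ∧ z₁ ≠ δ r) →
    IsAngleOn (fun r => angular z₀ z₁ (δ r)) s t θ → |θ t - θ s| ≤ B

/-- The ends of a lifted arc may lie over `z₀` or `z₁`, where `angular` vanishes; width bounds reach
them by continuity. -/
theorem abs_sub_le_of_Ioo {f : ℝ → ℝ} {s t R : ℝ} (hf : ContinuousOn f (Set.Icc s t)) (hR : 0 ≤ R)
    (h : ∀ a ∈ Set.Ioo s t, ∀ b ∈ Set.Ioo s t, |f a - f b| ≤ R) :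
    ∀ a ∈ Set.Icc s t, ∀ b ∈ Set.Icc s t, |f a - f b| ≤ R := by
  intro a ha b hb
  rcases (ha.1.trans ha.2).eq_or_lt with rfl | hst
  · rw [Set.Icc_self] at ha hb
    rwa [Set.mem_singleton_iff.1 ha, Set.mem_singleton_iff.1 hb, sub_self, abs_zero]
  have hcl : ∀ c ∈ Set.Icc s t, f c ∈ closure (f '' Set.Ioo s t) := by
    rw [← closure_Ioo hst.ne] at hf ⊢
    exact fun c hc => hf.image_closure ⟨c, hc, rfl⟩
  have h1 : ∀ c ∈ Set.Ioo s t, ∀ y ∈ closure (f '' Set.Ioo s t), |f c - y| ≤ R := by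
    intro c hc y hy
    refine closure_minimal (t := {y | |f c - y| ≤ R}) ?_
      (isClosed_le (by fun_prop) continuous_const) hy
    rintro _ ⟨e, he, rfl⟩
    exact h c hc e he
  refine closure_minimal (t := {y | |y - f b| ≤ R}) ?_
    (isClosed_le (by fun_prop) continuous_const) (hcl a ha)
  rintro _ ⟨c, hc, rfl⟩
  exact h1 c hc _ (hcl b hb)

theorem IsUniversalCover.exists_lift_bound (hz : z₀ ≠ z₁) {π : Strip → BlowUp z₀ z₁}
    (hπ : IsUniversalCover z₀ z₁ π) : ∃ K : ℝ, ∀ (δ : ℝ → S2) (B : ℝ) (s t : ℝ) (d : ℝ → Strip),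
      0 ≤ B → WindsAtMost z₀ z₁ δ B → 0 ≤ s → t ≤ 1 → IsLift π δ s t d →
      (∀ r ∈ Set.Ioo s t, z₀ ≠ δ r ∧ z₁ ≠ δ r) →
      ∀ a ∈ Set.Icc s t, ∀ b ∈ Set.Icc s t, |(d a).1 - (d b).1| ≤ B + K := by
  obtain ⟨θ, K, hθ, hexp, hK⟩ := hπ.exists_angle hz
  have hK0 : 0 ≤ K := by simpa using hK (0, 0) (0, 0)
  refine ⟨K, fun δ B s t d hB hδ hs ht hd hav => ?_⟩
  refine abs_sub_le_of_Ioo (continuous_fst.comp_continuousOn hd.1) (by positivity) ?_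
  have key : ∀ a ∈ Set.Ioo s t, ∀ b ∈ Set.Ioo s t, a ≤ b → |θ (d b) - θ (d a)| ≤ B := by
    intro a ha b hb hab
    have hav' : ∀ r ∈ Set.Icc a b, z₀ ≠ δ r ∧ z₁ ≠ δ r := fun r hr =>
      hav r ⟨ha.1.trans_le hr.1, hr.2.trans_lt hb.2⟩
    have hd' : IsLift π δ a b d :=
      ⟨hd.1.mono (Set.Icc_subset_Icc ha.1.le hb.2.le),
        fun r hr => hd.2 r (Set.Icc_subset_Icc ha.1.le hb.2.le hr)⟩
    exact hδ a b _ (hs.trans ha.1.le) hab (hb.2.le.trans ht) hav' (hd'.isAngleOn hθ hexp hav')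
  intro a ha b hb
  refine (hK (d a) (d b)).trans (add_le_add ?_ le_rfl)
  rcases le_total a b with hab | hab
  · rw [abs_sub_comm]; exact key a ha b hb hab
  · exact key b hb a ha hab

/-- If `A` meets the `i`-th and the `j`-th translate of `C`, then `j - i` is a difference of first
coordinates in `A` minus one in `C`. -/
theorem liftedSpread_le {A C : Set Strip} {R R' : ℝ}
    (hA : ∀ p ∈ A, ∀ q ∈ A, |p.1 - q.1| ≤ R) (hC : ∀ p ∈ C, ∀ q ∈ C, |p.1 - q.1| ≤ R') :
    liftedSpread A C ≤ (⌈R + R'⌉₊ : ℕ∞) := by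
  refine iSup₂_le fun i hi => iSup₂_le fun j hj => ?_
  obtain ⟨p, hpA, p', hpC, hp⟩ := hi
  obtain ⟨q, hqA, q', hqC, hq⟩ := hj
  have h1 := hA q hqA p hpA
  have h2 := hC q' hqC p' hpC
  have e1 : p.1 = p'.1 + i := by rw [← hp]; rfl
  have e2 : q.1 = q'.1 + j := by rw [← hq]; rfl
  rw [abs_le] at h1 h2
  have h3 : ((j - i : ℤ) : ℝ) ≤ (⌈R + R'⌉₊ : ℝ) := by
    refine le_trans ?_ (Nat.le_ceil _)
    push_cast
    linarith [h1.2, h2.1]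
  have h4 : j - i ≤ (⌈R + R'⌉₊ : ℤ) := by exact_mod_cast h3
  exact_mod_cast Int.toNat_le.2 h4

end Lifts

/-! ### Sublinear growth of the winding -/

section Conclusion

variable {z₀ z₁ : S2}

theorem spread_eq_zero_of_linear_bound {π : Strip → BlowUp z₀ z₁} {f : Diff1} {β : Circle → S2}
    {γ α : ℝ → S2} {m : ℕ → ℕ} {C D : ℝ} (hC : 0 ≤ C)
    (hm : Filter.Tendsto (fun n : ℕ => (m n : ℝ) / n) Filter.atTop (𝓝 0))
    (h : ∀ n, curveSpread π β γ (fun t => (f ^ n) (α t)) ≤ (⌈C * m n + D⌉₊ : ℕ∞)) :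
    spread π f β γ α = 0 := by
  -- The summand `1` absorbs the rounding up.
  have hlim : Filter.Tendsto (fun n : ℕ => C * ((m n : ℝ) / n) + (|D| + 1) / n) Filter.atTop
      (𝓝 0) := by
    have h2 := tendsto_const_div_atTop_nhds_zero_nat (|D| + 1)
    simpa using (hm.const_mul C).add h2
  have hlim' := ENNReal.tendsto_ofReal hlim
  rw [ENNReal.ofReal_zero] at hlim'
  refine le_antisymm ?_ zero_le
  rw [← hlim'.liminf_eq]
  refine Filter.liminf_le_liminf ?_
  filter_upwards [Filter.eventually_gt_atTop 0] with n hn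
  have hn' : (0 : ℝ) < n := by exact_mod_cast hn
  have e : C * ((m n : ℝ) / n) + (|D| + 1) / n = (C * m n + |D| + 1) / n := by ring
  have hnn : 0 ≤ C * m n + |D| := by positivity
  rw [e, ENNReal.ofReal_div_of_pos hn', ENNReal.ofReal_natCast]
  refine ENNReal.div_le_div_right ?_ _
  refine (ENat.toENNReal_le.2 (h n)).trans ?_
  rw [ENat.toENNReal_coe, ← ENNReal.ofReal_natCast]
  refine ENNReal.ofReal_le_ofReal ?_
  have h1 : ⌈C * m n + D⌉₊ ≤ ⌈C * m n + |D|⌉₊ :=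
    Nat.ceil_mono (add_le_add le_rfl (le_abs_self D))
  have h2 := (Nat.ceil_lt_add_one hnn).le
  exact le_trans (by exact_mod_cast h1) h2

theorem curveSpread_le {π : Strip → BlowUp z₀ z₁} {β : Circle → S2} {γ δ : ℝ → S2} {R R' : ℝ}
    (hγ : ∀ g, IsLift π γ 0 1 g →
      ∀ a ∈ Set.Icc (0 : ℝ) 1, ∀ b ∈ Set.Icc (0 : ℝ) 1, |(g a).1 - (g b).1| ≤ R')
    (hδ : ∀ s t d, 0 ≤ s → t ≤ 1 → IsLift π δ s t d →
      ∀ a ∈ Set.Icc s t, ∀ b ∈ Set.Icc s t, |(d a).1 - (d b).1| ≤ R) :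
    curveSpread π β γ δ ≤ (⌈R + R'⌉₊ : ℕ∞) := by
  refine iSup₂_le fun g hg => iSup₂_le fun s t => iSup₂_le fun hst d => iSup_le fun hd => ?_
  apply liftedSpread_le
  · rintro _ ⟨a, ha, rfl⟩ _ ⟨b, hb, rfl⟩
    exact hδ s t d hst.1 hst.2.2 hd a ha b hb
  · rintro _ ⟨a, ha, rfl⟩ _ ⟨b, hb, rfl⟩
    exact hγ g hg a ha b hb

/-- Winding of `g ∘ α` about `z₀, z₁` is compared with winding of `α` about their preimages. -/
theorem AngleBound.windsAtMost {g : Diff1} {C D : ℝ} (hg : AngleBound g C) {α : ℝ → S2}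
    (hα : ContinuousOn α (Set.Icc 0 1)) (h : WindsAtMost (g⁻¹ z₀) (g⁻¹ z₁) α D) :
    WindsAtMost z₀ z₁ (fun t => g (α t)) (C + D) := by
  intro s t θ hs hst ht hav hθ
  have hinv : ∀ z, g (g⁻¹ z) = z := fun z => by rw [← mul_apply, mul_inv_cancel, one_apply]
  have hav' : ∀ r ∈ Set.Icc s t, g⁻¹ z₀ ≠ α r ∧ g⁻¹ z₁ ≠ α r := by
    intro r hr
    constructor
    · intro h0
      exact (hav r hr).1 (show z₀ = g (α r) by rw [← h0, hinv])
    · intro h0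
      exact (hav r hr).2 (show z₁ = g (α r) by rw [← h0, hinv])
  have hα' := hα.mono (Set.Icc_subset_Icc hs ht)
  obtain ⟨κ, hκ⟩ := exists_isAngleOn_angular hst hα' hav'
  have h1 := h s t κ hs hst ht hav' hκ
  have h2 := hg _ _ α s t κ θ hst hα' hav' hκ (by simpa only [hinv] using hθ)
  have h3 := abs_add_le ((θ t - θ s) - (κ t - κ s)) (κ t - κ s)
  rw [sub_add_cancel] at h3
  linarith

/-- The two cases of the theorem differ only in `hwind`, with `D` independent of `n`, and in
`hlift`; both are isolated here as hypotheses. -/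
theorem spread_eq_zero {f : Diff1Zero} (hf : IsDistortionElement f) (hz : z₀ ≠ z₁)
    {π : Strip → BlowUp z₀ z₁} (hπ : IsUniversalCover z₀ z₁ π) {β : Circle → S2}
    {γ : ℝ → S2} (hγ : IsSmoothCurve γ) {α : ℝ → S2} (hα : ContinuousOn α (Set.Icc 0 1)) {D : ℝ}
    (hD : 0 ≤ D)
    (hwind : ∀ n : ℕ, WindsAtMost (((f : Diff1) ^ n)⁻¹ z₀) (((f : Diff1) ^ n)⁻¹ z₁) α D)
    (hlift : ∀ (n : ℕ) (s t : ℝ) (d : ℝ → Strip), 0 ≤ s → t ≤ 1 →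
      IsLift π (fun t => ((f : Diff1) ^ n) (α t)) s t d →
      ∀ r ∈ Set.Ioo s t, z₀ ≠ ((f : Diff1) ^ n) (α r) ∧ z₁ ≠ ((f : Diff1) ^ n) (α r)) :
    spread π (f : Diff1) β γ α = 0 := by
  obtain ⟨-, S, hfS, hlim⟩ := hf
  obtain ⟨C, hC, hCS⟩ := exists_angleBound_wordLength S
  obtain ⟨K, hK⟩ := hπ.exists_lift_bound hz
  obtain ⟨G, hG⟩ := hγ.exists_turnsAtMost
  have hγwind : WindsAtMost z₀ z₁ γ |G| := fun s t θ hs hst ht hav hθ =>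
    (hG s t hs hst ht _ _ θ hav hθ).trans (le_abs_self G)
  -- The constant `K` enters twice, for the width of a lift of `f ^ n ∘ α` and for that of a lift of
  -- `γ`.
  refine spread_eq_zero_of_linear_bound (D := 2 * Real.pi + D + K + (|G| + K)) hC hlim fun n => ?_
  have hn := hCS (f ^ n) (pow_mem hfS n)
  rw [Subgroup.coe_pow] at hn
  have hw := hn.windsAtMost hα (hwind n)
  have hpos : 0 ≤ C * wordLength (S : Set Diff1Zero) (f ^ n) + 2 * Real.pi + D := by positivity
  refine (curveSpread_le
    (R := C * wordLength (S : Set Diff1Zero) (f ^ n) + 2 * Real.pi + D + K) (R' := |G| + K)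
    (fun g hg => hK γ _ 0 1 g (abs_nonneg G) hγwind le_rfl le_rfl hg
      fun r hr => hγ.ne_of_isLift hπ le_rfl le_rfl hg hr)
    fun s t d hs ht hd => hK _ _ s t d hpos hw hs ht hd (hlift n s t d hs ht hd)).trans_eq ?_
  congr 2
  ring

end Conclusion

end Spread

open Spread in
theorem mainTheorem4 (f : Diff1Zero) (hf : IsDistortionElement f)
    (z₀ z₁ : S2) (hz : z₀ ≠ z₁)
    (π : Strip → BlowUp z₀ z₁) (hπ : IsUniversalCover z₀ z₁ π)
    (β : Circle → S2) (hβ : Continuous β) (hβ_inj : Function.Injective β)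
    (hβ_mem : z₁ ∉ Set.range β)
    (γ : ℝ → S2) (hγ : IsSmoothCurve γ) (hγ_zero : γ 0 = z₀) (hγ_one : γ 1 = z₁) :
    (∀ α : ℝ → S2, IsSmoothCurve α → spread π (f : Diff1) β γ α = 0) ∧
    ((f : Diff1) z₀ = z₀ → (f : Diff1) z₁ = z₁ →
      ∀ α : ℝ → S2, ContinuousOn α (Set.Icc 0 1) →
        (∀ t ∈ Set.Icc (0 : ℝ) 1, α t ≠ z₀ ∧ α t ≠ z₁) →
        spread π (f : Diff1) β γ α = 0) := by
  refine ⟨fun α hα => ?_, fun h0 h1 α hα hav => ?_⟩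
  -- This `D` serves for every pair of points, hence for the preimages of `z₀, z₁` under all `f ^
  -- n`.
  · obtain ⟨D, hD⟩ := hα.exists_turnsAtMost
    refine spread_eq_zero hf hz hπ hγ
      (Topology.IsInducing.subtypeVal.continuousOn_iff.2 hα.1.continuousOn) (abs_nonneg D)
      (fun n s t θ hs hst ht hav hθ => (hD s t hs hst ht _ _ θ hav hθ).trans (le_abs_self D))
      fun n s t d hs ht hd r hr => (hα.comp _).ne_of_isLift hπ hs ht hd hr
  · have fix : ∀ z, (f : Diff1) z = z → ∀ n : ℕ, ((f : Diff1) ^ n) z = z := by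
      intro z hz n
      induction n with
      | zero => rw [pow_zero, one_apply]
      | succ n ih => rw [pow_succ, mul_apply, hz, ih]
    have fix_inv : ∀ z, (f : Diff1) z = z → ∀ n : ℕ, ((f : Diff1) ^ n)⁻¹ z = z := by
      intro z hz n
      conv_lhs => rw [← fix z hz n]
      rw [← mul_apply, inv_mul_cancel, one_apply]
    have hav' : ∀ r ∈ Set.Icc (0 : ℝ) 1, z₀ ≠ α r ∧ z₁ ≠ α r := fun r hr =>
      ⟨(hav r hr).1.symm, (hav r hr).2.symm⟩
    -- The preimages of `z₀, z₁` under `f ^ n` are `z₀, z₁` themselves, so a bound for this one pair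
    -- suffices.
    obtain ⟨D, hD⟩ := exists_angle_bound_of_avoid hα hav'
    refine spread_eq_zero hf hz hπ hγ hα (abs_nonneg D) (fun n => ?_)
      fun n s t d hs ht hd r hr => ?_
    · rw [fix_inv z₀ h0, fix_inv z₁ h1]
      exact fun s t θ hs hst ht _ hθ => (hD s t θ hs hst ht hθ).trans (le_abs_self D)
    · have hr' := hav' r ⟨hs.trans hr.1.le, hr.2.le.trans ht⟩
      constructor
      · intro h
        rw [← fix z₀ h0 n] at h
        exact hr'.1 (((f : Diff1) ^ n).injective h)
      · intro h
        rw [← fix z₁ h1 n] at h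
        exact hr'.2 (((f : Diff1) ^ n).injective h)
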